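/- Work over $\mathbb{C}$. Let $A$ and $H$ be Hopf algebras with bijective antipodes, let $\pi : A \to H$ be a surjective Hopf algebra homomorphism, and let $B = A^{\mathrm{co}(H)} = \{a \in A : (\mathrm{id}\otimes\pi)\Delta(a) = a \otimes 1\}$. Then $B$ is a left $A$-comodule algebra with coaction $\Delta|_B : B \to A \otimes B$. Assume that $B$ is a quantum homogeneous space, i.e. that $A$ is faithfully flat as a right $B$-module, and that $H$ is cosemisimple, i.e. a direct sum of simple subcoalgebras. Let ${}^A_B\mathrm{Mod}_B$ be the category whose objects are the $B$-bimodules $M$ with a left $A$-comodule structure $\delta_M : M \to A \otimes M$ such that $\delta_M(b m c) = \Delta(b)\,\delta_M(m)\,\Delta(c)$ for $b, c \in B$, $m \in M$, and whose morphisms are the $B$-bilinear left $A$-colinear maps; the tensor product $M \otimes_B N$ of two objects carries the diagonal coaction $m \otimes_B n \mapsto m_{(-1)} n_{(-1)} \otimes (m_{(0)} \otimes_B n_{(0)})$. Let ${}^A_B\mathrm{Mod}_0$ be the full subcategory of those $M$ that are finitely generated as left $B$-modules and satisfy $M B^+ = B^+ M$, where $B^+ = B \cap \ker \epsilon$. Let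 $(\Omega^\bullet = \bigoplus_{k \ge 0} \Omega^k, \wedge, d)$ be an $A$-covariant differential calculus on $B$: a differential graded algebra with $\Omega^0 = B$, generated as an algebra by $B$ and $dB$, such that every $\Omega^k$ is an object of ${}^A_B\mathrm{Mod}_B$ (with $\Omega^0 = B$ carrying the coaction $\Delta|_B$), every multiplication map $\wedge : \Omega^k \otimes_B \Omega^l \to \Omega^{k+l}$ is a morphism of ${}^A_B\mathrm{Mod}_B$, and every $d : \Omega^k \to \Omega^{k+1}$ is left $A$-colinear. Suppose that every $\Omega^k$ is an object of ${}^A_B\mathrm{Mod}_0$. Then $(\Omega^\bullet, \wedge, d)$ is covariantly quasi-tame: there is a morphism $s : \Omega^2 \to \Omega^1 \otimes_B \Omega^1$ of ${}^A_B\mathrm{Mod}_B$ such that $\wedge \circ s = \mathrm{id}_{\Omega^2}$. -/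

import Mathlib

open scoped TensorProduct

universe u

set_option linter.unusedSectionVars false

noncomputable section

namespace QHS

/-! ### Balanced tensor products over a noncommutative algebra -/

section BTensor

variable (B : Type*) [Ring B] [Algebra ℂ B]
variable (M N : Type*) [AddCommGroup M] [Module ℂ M] [Module Bᵐᵒᵖ M]
  [AddCommGroup N] [Module ℂ N] [Module B N]

/-- The subspace of `M ⊗ N` spanned by the elements `m b ⊗ n - m ⊗ b n`. -/
def balanced : Submodule ℂ (M ⊗[ℂ] N) :=
  Submodule.span ℂ {t | ∃ (m : M) (b : B) (n : N),
    t = (MulOpposite.op b • m) ⊗ₜ[ℂ] n - m ⊗ₜ[ℂ] (b • n)}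

/-- The tensor product `M ⊗_B N` of a right `B`-module `M` and a left `B`-module `N`. -/
def BTensor : Type _ := (M ⊗[ℂ] N) ⧸ balanced B M N

instance : AddCommGroup (BTensor B M N) :=
  inferInstanceAs (AddCommGroup ((M ⊗[ℂ] N) ⧸ balanced B M N))

instance : Module ℂ (BTensor B M N) :=
  inferInstanceAs (Module ℂ ((M ⊗[ℂ] N) ⧸ balanced B M N))

namespace BTensor

/-- The quotient map `M ⊗ N → M ⊗_B N`. -/
def proj : M ⊗[ℂ] N →ₗ[ℂ] BTensor B M N := (balanced B M N).mkQ

/-- The pairing `(m, n) ↦ m ⊗_B n`. -/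
def mk : M →ₗ[ℂ] N →ₗ[ℂ] BTensor B M N :=
  (TensorProduct.mk ℂ M N).compr₂ (proj B M N)

variable {M N}

theorem mk_balanced (m : M) (b : B) (n : N) :
    mk B M N (MulOpposite.op b • m) n = mk B M N m (b • n) :=
  (Submodule.Quotient.eq (balanced B M N)).2 (Submodule.subset_span ⟨m, b, n, rfl⟩)

/-- A balanced `ℂ`-bilinear map `M × N → P` factors through `M ⊗_B N`. -/
def lift {P : Type*} [AddCommGroup P] [Module ℂ P] (f : M →ₗ[ℂ] N →ₗ[ℂ] P)
    (hf : ∀ (m : M) (b : B) (n : N), f (MulOpposite.op b • m) n = f m (b • n)) :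
    BTensor B M N →ₗ[ℂ] P :=
  (balanced B M N).liftQ (TensorProduct.lift f) <| by
    rw [balanced, Submodule.span_le]
    rintro _ ⟨m, b, n, rfl⟩
    simp [hf]

@[simp] theorem lift_mk {P : Type*} [AddCommGroup P] [Module ℂ P] (f : M →ₗ[ℂ] N →ₗ[ℂ] P)
    (hf : ∀ (m : M) (b : B) (n : N), f (MulOpposite.op b • m) n = f m (b • n))
    (m : M) (n : N) : lift B f hf (mk B M N m n) = f m n := by
  change (balanced B M N).liftQ (TensorProduct.lift f) _ (Submodule.Quotient.mk (m ⊗ₜ n)) = _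
  rw [Submodule.liftQ_apply, TensorProduct.lift.tmul]

variable {B} in
theorem induction_on {p : BTensor B M N → Prop} (t : BTensor B M N) (zero : p 0)
    (tmul : ∀ m n, p (mk B M N m n)) (add : ∀ s t, p s → p t → p (s + t)) : p t := by
  obtain ⟨x, rfl⟩ := (balanced B M N).mkQ_surjective t
  induction x with
  | zero => exact zero
  | tmul m n => exact tmul m n
  | add x y hx hy => exact add _ _ hx hy

variable {B} in
theorem hom_ext {P : Type*} [AddCommGroup P] [Module ℂ P] {f g : BTensor B M N →ₗ[ℂ] P}
    (h : ∀ m n, f (mk B M N m n) = g (mk B M N m n)) : f = g := by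
  ext t
  induction t using induction_on with
  | zero => simp
  | tmul m n => exact h m n
  | add s t hs ht => simp [hs, ht]

/-- For a left `B`-linear map `f : N → N'`, the map `id ⊗_B f : M ⊗_B N → M ⊗_B N'`. -/
def lTensor (M : Type*) [AddCommGroup M] [Module ℂ M] [Module Bᵐᵒᵖ M]
    {N' : Type*} [AddCommGroup N'] [Module ℂ N'] [Module B N']
    [IsScalarTower ℂ B N] [IsScalarTower ℂ B N'] (f : N →ₗ[B] N') :
    BTensor B M N →ₗ[ℂ] BTensor B M N' :=
  lift B ((mk B M N').compl₂ (f.restrictScalars ℂ)) fun m b n => by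
    simp [mk_balanced]

end BTensor

end BTensor

/-! ### Bimodule structure on the balanced tensor product -/

section Bimodule

variable (B : Type*) [Ring B] [Algebra ℂ B]
variable (M N : Type*)
  [AddCommGroup M] [Module ℂ M] [Module B M] [Module Bᵐᵒᵖ M]
  [IsScalarTower ℂ B M] [IsScalarTower ℂ Bᵐᵒᵖ M] [SMulCommClass B Bᵐᵒᵖ M]
  [AddCommGroup N] [Module ℂ N] [Module B N] [Module Bᵐᵒᵖ N]
  [IsScalarTower ℂ B N] [IsScalarTower ℂ Bᵐᵒᵖ N] [SMulCommClass B Bᵐᵒᵖ N]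

/-- The left action `(b, m) ↦ b m` as a `ℂ`-bilinear map. -/
def actL (M : Type*) [AddCommGroup M] [Module ℂ M] [Module B M] [IsScalarTower ℂ B M] :
    B →ₗ[ℂ] M →ₗ[ℂ] M :=
  (Algebra.lsmul ℂ ℂ M : B →ₐ[ℂ] Module.End ℂ M).toLinearMap

/-- The right action `(m, b) ↦ m b` as a `ℂ`-bilinear map. -/
def actR (M : Type*) [AddCommGroup M] [Module ℂ M] [Module Bᵐᵒᵖ M]
    [IsScalarTower ℂ Bᵐᵒᵖ M] : M →ₗ[ℂ] B →ₗ[ℂ] M :=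
  ((actL Bᵐᵒᵖ M).comp (MulOpposite.opLinearEquiv ℂ).toLinearMap).flip

@[simp] theorem actL_apply (M : Type*) [AddCommGroup M] [Module ℂ M] [Module B M]
    [IsScalarTower ℂ B M] (b : B) (m : M) : actL B M b m = b • m := rfl

@[simp] theorem actR_apply (M : Type*) [AddCommGroup M] [Module ℂ M] [Module Bᵐᵒᵖ M]
    [IsScalarTower ℂ Bᵐᵒᵖ M] (b : B) (m : M) : actR B M m b = MulOpposite.op b • m := rfl

namespace BTensor

/-- `b (m ⊗_B n) = b m ⊗_B n`. -/
instance : SMul B (BTensor B M N) where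
  smul b := lift B ((mk B M N).comp (actL B M b)) fun m c n => by
    simp [smul_comm b (MulOpposite.op c) m, mk_balanced]

/-- `(m ⊗_B n) b = m ⊗_B n b`. -/
instance : SMul Bᵐᵒᵖ (BTensor B M N) where
  smul b := lift B ((mk B M N).compl₂ (actL Bᵐᵒᵖ N b)) fun m c n => by
    simp [← smul_comm c b n, mk_balanced]

variable {M N}

@[simp] theorem smul_mk (b : B) (m : M) (n : N) :
    b • mk B M N m n = mk B M N (b • m) n := lift_mk B _ _ m n

@[simp] theorem op_smul_mk (b : Bᵐᵒᵖ) (m : M) (n : N) :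
    b • mk B M N m n = mk B M N m (b • n) := lift_mk B _ _ m n

theorem smul_add_l (b : B) (s t : BTensor B M N) : b • (s + t) = b • s + b • t :=
  LinearMap.map_add _ s t

theorem smul_zero_l (b : B) : b • (0 : BTensor B M N) = 0 := LinearMap.map_zero _

theorem smul_add_r (b : Bᵐᵒᵖ) (s t : BTensor B M N) : b • (s + t) = b • s + b • t :=
  LinearMap.map_add _ s t

theorem smul_zero_r (b : Bᵐᵒᵖ) : b • (0 : BTensor B M N) = 0 := LinearMap.map_zero _

instance : Module B (BTensor B M N) where
  smul_add := smul_add_l B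
  smul_zero := smul_zero_l B
  one_smul t := by
    induction t using induction_on with
    | zero => exact smul_zero_l B _
    | tmul m n => simp
    | add s t hs ht => rw [smul_add_l, hs, ht]
  mul_smul b c t := by
    induction t using induction_on with
    | zero => simp only [smul_zero_l]
    | tmul m n => simp [mul_smul]
    | add s t hs ht => simp only [smul_add_l, hs, ht]
  zero_smul t := by
    induction t using induction_on with
    | zero => exact smul_zero_l B _
    | tmul m n => simp
    | add s t hs ht => rw [smul_add_l, hs, ht, add_zero]
  add_smul b c t := by
    induction t using induction_on with
    | zero => simp only [smul_zero_l, add_zero]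
    | tmul m n => simp [add_smul]
    | add s t hs ht => simp only [smul_add_l, hs, ht]; abel

instance : Module Bᵐᵒᵖ (BTensor B M N) where
  smul_add := smul_add_r B
  smul_zero := smul_zero_r B
  one_smul t := by
    induction t using induction_on with
    | zero => exact smul_zero_r B _
    | tmul m n => simp
    | add s t hs ht => rw [smul_add_r, hs, ht]
  mul_smul b c t := by
    induction t using induction_on with
    | zero => simp only [smul_zero_r]
    | tmul m n => simp [mul_smul]
    | add s t hs ht => simp only [smul_add_r, hs, ht]
  zero_smul t := by
    induction t using induction_on with
    | zero => exact smul_zero_r B _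
    | tmul m n => simp
    | add s t hs ht => rw [smul_add_r, hs, ht, add_zero]
  add_smul b c t := by
    induction t using induction_on with
    | zero => simp only [smul_zero_r, add_zero]
    | tmul m n => simp [add_smul]
    | add s t hs ht => simp only [smul_add_r, hs, ht]; abel

instance : SMulCommClass B Bᵐᵒᵖ (BTensor B M N) where
  smul_comm b c t := by
    induction t using induction_on with
    | zero => simp only [smul_zero]
    | tmul m n => simp
    | add s t hs ht => simp only [smul_add, hs, ht]

instance : IsScalarTower ℂ B (BTensor B M N) where
  smul_assoc z b t := by
    induction t using induction_on with
    | zero => simp only [smul_zero]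
    | tmul m n => simp
    | add s t hs ht => simp only [smul_add, hs, ht]

instance : IsScalarTower ℂ Bᵐᵒᵖ (BTensor B M N) where
  smul_assoc z b t := by
    induction t using induction_on with
    | zero => simp only [smul_zero]
    | tmul m n => simp
    | add s t hs ht => simp only [smul_add, hs, ht]

end BTensor

end Bimodule

/-! ### Comodules, comodule algebras and relative Hopf modules -/

/-- A left comodule `V` over a coalgebra `A`. -/
class LeftComodule (A V : Type*) [AddCommGroup A] [Module ℂ A] [Coalgebra ℂ A]
    [AddCommGroup V] [Module ℂ V] where
  /-- The coaction `v ↦ v₍₋₁₎ ⊗ v₍₀₎`. -/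
  coact : V →ₗ[ℂ] A ⊗[ℂ] V
  coassoc : ∀ v, TensorProduct.assoc ℂ A A V
    ((Coalgebra.comul (R := ℂ) (A := A)).rTensor V (coact v)) = coact.lTensor A (coact v)
  counit : ∀ v, (Coalgebra.counit (R := ℂ) (A := A)).rTensor V (coact v) = 1 ⊗ₜ[ℂ] v

/-- The coaction on a left `A`-comodule `V`. -/
def coaction (A V : Type*) [AddCommGroup A] [Module ℂ A] [Coalgebra ℂ A]
    [AddCommGroup V] [Module ℂ V] [LeftComodule A V] : V →ₗ[ℂ] A ⊗[ℂ] V :=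
  LeftComodule.coact

/-- `f : V → W` is `A`-covariant: `δ (f v) = (id ⊗ f) (δ v)`. -/
def IsCovariantMap (A : Type*) {V W : Type*} [AddCommGroup A] [Module ℂ A] [Coalgebra ℂ A]
    [AddCommGroup V] [Module ℂ V] [LeftComodule A V]
    [AddCommGroup W] [Module ℂ W] [LeftComodule A W] (f : V →ₗ[ℂ] W) : Prop :=
  ∀ v, coaction A W (f v) = f.lTensor A (coaction A V v)

/-- For a bilinear map `μ : U × V → W`, the bilinear map
`(a ⊗ u, a' ⊗ v) ↦ a a' ⊗ μ u v`. -/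
def diagonal (A : Type*) [Ring A] [Algebra ℂ A] {U V W : Type*}
    [AddCommGroup U] [Module ℂ U] [AddCommGroup V] [Module ℂ V] [AddCommGroup W] [Module ℂ W]
    (μ : U →ₗ[ℂ] V →ₗ[ℂ] W) : A ⊗[ℂ] U →ₗ[ℂ] A ⊗[ℂ] V →ₗ[ℂ] A ⊗[ℂ] W :=
  TensorProduct.map₂ (LinearMap.mul ℂ A) μ

@[simp] theorem diagonal_tmul (A : Type*) [Ring A] [Algebra ℂ A] {U V W : Type*}
    [AddCommGroup U] [Module ℂ U] [AddCommGroup V] [Module ℂ V] [AddCommGroup W] [Module ℂ W]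
    (μ : U →ₗ[ℂ] V →ₗ[ℂ] W) (a a' : A) (x : U) (v : V) :
    diagonal A μ (a ⊗ₜ x) (a' ⊗ₜ v) = (a * a') ⊗ₜ μ x v := rfl

/-- A left `A`-comodule algebra `B`: the coaction is multiplicative and unital. -/
class LeftComoduleAlgebra (A B : Type*) [Ring A] [Bialgebra ℂ A] [Ring B] [Algebra ℂ B]
    extends LeftComodule A B where
  coact_one : coact 1 = 1 ⊗ₜ[ℂ] 1
  coact_mul : ∀ b c, coact (b * c) = coact b * coact c

/-- The objects of `^A_B Mod_B`: a `B`-bimodule `M` with a left `A`-coaction satisfying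
`δ (b m) = δ b δ m` and `δ (m b) = δ m δ b`. -/
class IsRelHopfBimodule (A B M : Type*) [Ring A] [Bialgebra ℂ A] [Ring B] [Algebra ℂ B]
    [LeftComoduleAlgebra A B] [AddCommGroup M] [Module ℂ M] [Module B M] [Module Bᵐᵒᵖ M]
    [IsScalarTower ℂ B M] [IsScalarTower ℂ Bᵐᵒᵖ M] [SMulCommClass B Bᵐᵒᵖ M]
    [LeftComodule A M] : Prop where
  coaction_smul : ∀ (b : B) (m : M),
    coaction A M (b • m) = diagonal A (actL B M) (coaction A B b) (coaction A M m)
  coaction_op_smul : ∀ (b : B) (m : M),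
    coaction A M (MulOpposite.op b • m) = diagonal A (actR B M) (coaction A M m) (coaction A B b)

/-- The morphisms of `^A_B Mod_B`: `B`-bilinear `A`-covariant maps. -/
structure IsRelHopfMorphism (A B : Type*) {M N : Type*} [Ring A] [Bialgebra ℂ A] [Ring B]
    [AddCommGroup M] [Module ℂ M] [Module B M] [Module Bᵐᵒᵖ M] [LeftComodule A M]
    [AddCommGroup N] [Module ℂ N] [Module B N] [Module Bᵐᵒᵖ N] [LeftComodule A N]
    (f : M →ₗ[ℂ] N) : Prop where
  map_smul : ∀ (b : B) (m : M), f (b • m) = b • f m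
  map_op_smul : ∀ (b : B) (m : M), f (MulOpposite.op b • m) = MulOpposite.op b • f m
  covariant : IsCovariantMap A f

/-! ### The diagonal coaction on `M ⊗_B N` -/

section TensorCoaction

/-- For bilinear `f : U × V → U'`, `g : U' × W → X`, `f' : V × W → W'`, `g' : U × W' → X` with
`g (f u v) w = g' u (f' v w)`, the diagonal extensions satisfy the same identity. -/
theorem diagonal_assoc (A : Type*) [Ring A] [Algebra ℂ A] {U V W U' W' X : Type*}
    [AddCommGroup U] [Module ℂ U] [AddCommGroup V] [Module ℂ V] [AddCommGroup W] [Module ℂ W]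
    [AddCommGroup U'] [Module ℂ U'] [AddCommGroup W'] [Module ℂ W']
    [AddCommGroup X] [Module ℂ X]
    (f : U →ₗ[ℂ] V →ₗ[ℂ] U') (g : U' →ₗ[ℂ] W →ₗ[ℂ] X)
    (f' : V →ₗ[ℂ] W →ₗ[ℂ] W') (g' : U →ₗ[ℂ] W' →ₗ[ℂ] X)
    (h : ∀ x v w, g (f x v) w = g' x (f' v w))
    (x : A ⊗[ℂ] U) (y : A ⊗[ℂ] V) (z : A ⊗[ℂ] W) :
    diagonal A g (diagonal A f x y) z = diagonal A g' x (diagonal A f' y z) := by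
  induction x with
  | zero => simp
  | add x x' hx hx' => simp [hx, hx']
  | tmul a x =>
    induction y with
    | zero => simp
    | add y y' hy hy' => simp [hy, hy']
    | tmul b y =>
      induction z with
      | zero => simp
      | add z z' hz hz' => simp only [map_add, hz, hz']
      | tmul c z => simp [h, mul_assoc]

variable (A B : Type*) [Ring A] [Bialgebra ℂ A] [Ring B] [Algebra ℂ B]
  [LeftComoduleAlgebra A B]
variable (M N : Type*)
  [AddCommGroup M] [Module ℂ M] [Module B M] [Module Bᵐᵒᵖ M]
  [IsScalarTower ℂ B M] [IsScalarTower ℂ Bᵐᵒᵖ M] [SMulCommClass B Bᵐᵒᵖ M]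
  [LeftComodule A M] [IsRelHopfBimodule A B M]
  [AddCommGroup N] [Module ℂ N] [Module B N] [Module Bᵐᵒᵖ N]
  [IsScalarTower ℂ B N] [IsScalarTower ℂ Bᵐᵒᵖ N] [SMulCommClass B Bᵐᵒᵖ N]
  [LeftComodule A N] [IsRelHopfBimodule A B N]

/-- `m ⊗_B n ↦ m₍₋₁₎ n₍₋₁₎ ⊗ (m₍₀₎ ⊗_B n₍₀₎)`. -/
def tensorCoaction : BTensor B M N →ₗ[ℂ] A ⊗[ℂ] BTensor B M N :=
  BTensor.lift B
    (((diagonal A (BTensor.mk B M N)).comp (coaction A M)).compl₂ (coaction A N))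
    fun m b n => by
      simp only [LinearMap.compl₂_apply, LinearMap.comp_apply,
        IsRelHopfBimodule.coaction_op_smul, IsRelHopfBimodule.coaction_smul]
      exact diagonal_assoc A _ _ _ _ (fun m b n => BTensor.mk_balanced B m b n) _ _ _

theorem tensorCoaction_mk (m : M) (n : N) :
    tensorCoaction A B M N (BTensor.mk B M N m n) =
      diagonal A (BTensor.mk B M N) (coaction A M m) (coaction A N n) :=
  BTensor.lift_mk B _ _ m n

variable {M N} in
theorem lTensor_tensorCoaction (x : A ⊗[ℂ] M) (y : A ⊗[ℂ] N) :
    (tensorCoaction A B M N).lTensor A (diagonal A (BTensor.mk B M N) x y) =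
      diagonal A (diagonal A (BTensor.mk B M N))
        ((coaction A M).lTensor A x) ((coaction A N).lTensor A y) := by
  induction x with
  | zero => simp
  | add x x' hx hx' => simp [hx, hx']
  | tmul a x =>
    induction y with
    | zero => simp
    | add y y' hy hy' => simp only [map_add, hy, hy']
    | tmul b y => simp [tensorCoaction_mk]

theorem assoc_comul_diagonal {U V W : Type*}
    [AddCommGroup U] [Module ℂ U] [AddCommGroup V] [Module ℂ V] [AddCommGroup W] [Module ℂ W]
    (μ : U →ₗ[ℂ] V →ₗ[ℂ] W) (x : A ⊗[ℂ] U) (y : A ⊗[ℂ] V) :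
    TensorProduct.assoc ℂ A A W
        ((Coalgebra.comul (R := ℂ) (A := A)).rTensor W (diagonal A μ x y)) =
      diagonal A (diagonal A μ)
        (TensorProduct.assoc ℂ A A U ((Coalgebra.comul (R := ℂ) (A := A)).rTensor U x))
        (TensorProduct.assoc ℂ A A V ((Coalgebra.comul (R := ℂ) (A := A)).rTensor V y)) := by
  induction x with
  | zero => simp
  | add x x' hx hx' => simp [hx, hx']
  | tmul a x =>
    induction y with
    | zero => simp
    | add y y' hy hy' => simp only [map_add, hy, hy']
    | tmul b y =>
      simp only [diagonal_tmul, LinearMap.rTensor_tmul, Bialgebra.comul_mul]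
      generalize Coalgebra.comul (R := ℂ) a = p
      generalize Coalgebra.comul (R := ℂ) b = q
      induction p with
      | zero => simp
      | add p p' hp hp' => simp only [add_mul, TensorProduct.add_tmul, map_add, hp, hp',
          LinearMap.add_apply]
      | tmul a a' =>
        induction q with
        | zero => simp
        | add q q' hq hq' => simp only [mul_add, TensorProduct.add_tmul, map_add, hq, hq']
        | tmul b b' => simp

theorem counit_diagonal {U V W : Type*}
    [AddCommGroup U] [Module ℂ U] [AddCommGroup V] [Module ℂ V] [AddCommGroup W] [Module ℂ W]
    (μ : U →ₗ[ℂ] V →ₗ[ℂ] W) (x : A ⊗[ℂ] U) (y : A ⊗[ℂ] V) :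
    (Coalgebra.counit (R := ℂ) (A := A)).rTensor W (diagonal A μ x y) =
      diagonal ℂ μ ((Coalgebra.counit (R := ℂ) (A := A)).rTensor U x)
        ((Coalgebra.counit (R := ℂ) (A := A)).rTensor V y) := by
  induction x with
  | zero => simp
  | add x x' hx hx' => simp [hx, hx']
  | tmul a x =>
    induction y with
    | zero => simp
    | add y y' hy hy' => simp only [map_add, hy, hy']
    | tmul b y => simp

instance : LeftComodule A (BTensor B M N) where
  coact := tensorCoaction A B M N
  coassoc t := by
    induction t using BTensor.induction_on with
    | zero => simp
    | add s t hs ht => simp only [map_add, hs, ht]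
    | tmul m n =>
      rw [tensorCoaction_mk, lTensor_tensorCoaction, assoc_comul_diagonal]
      congr 1
      · exact congrArg _ (LeftComodule.coassoc m)
      · exact LeftComodule.coassoc n
  counit t := by
    induction t using BTensor.induction_on with
    | zero => simp
    | add s t hs ht => simp only [map_add, hs, ht, TensorProduct.tmul_add]
    | tmul m n =>
      rw [tensorCoaction_mk, counit_diagonal]
      refine (congrArg₂ (fun x y => diagonal ℂ (BTensor.mk B M N) x y)
        (LeftComodule.counit m) (LeftComodule.counit n)).trans ?_
      simp

instance : IsRelHopfBimodule A B (BTensor B M N) where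
  coaction_smul b t := by
    induction t using BTensor.induction_on with
    | zero => simp
    | add s t hs ht => simp only [smul_add, map_add, hs, ht]
    | tmul m n =>
      change tensorCoaction A B M N _ = diagonal A _ _ (tensorCoaction A B M N _)
      rw [BTensor.smul_mk, tensorCoaction_mk, tensorCoaction_mk,
        IsRelHopfBimodule.coaction_smul]
      exact diagonal_assoc A _ _ _ _ (fun b m n => (BTensor.smul_mk B b m n).symm) _ _ _
  coaction_op_smul b t := by
    induction t using BTensor.induction_on with
    | zero => simp
    | add s t hs ht => simp only [smul_add, map_add, hs, ht, LinearMap.add_apply]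
    | tmul m n =>
      change tensorCoaction A B M N _ = diagonal A _ (tensorCoaction A B M N _) _
      rw [BTensor.op_smul_mk, tensorCoaction_mk, tensorCoaction_mk,
        IsRelHopfBimodule.coaction_op_smul]
      exact (diagonal_assoc A _ _ _ _
        (fun m n b => BTensor.op_smul_mk B (MulOpposite.op b) m n) _ _ _).symm

end TensorCoaction

/-! ### Differential calculi -/

/-- A differential calculus on `B`: a differential graded algebra `Ω = ⨁ Ω^k` with `Ω^0 = B`
(through `ofB`), generated as an algebra by `B` and `d B`. -/
structure DifferentialCalculus (B : Type*) [Ring B] [Algebra ℂ B]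
    {Ω : Type*} [Ring Ω] [Algebra ℂ Ω] (deg : ℕ → Submodule ℂ Ω) [GradedAlgebra deg] where
  ofB : B →ₐ[ℂ] Ω
  ofB_injective : Function.Injective ofB
  range_ofB : LinearMap.range ofB.toLinearMap = deg 0
  d : Ω →ₗ[ℂ] Ω
  d_mem : ∀ k, ∀ ω ∈ deg k, d ω ∈ deg (k + 1)
  d_d : ∀ ω, d (d ω) = 0
  leibniz : ∀ k, ∀ ω ∈ deg k, ∀ η, d (ω * η) = d ω * η + (-1) ^ k * (ω * d η)
  adjoin_eq_top : Algebra.adjoin ℂ (Set.range ofB ∪ Set.range fun b => d (ofB b)) = ⊤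

namespace DifferentialCalculus

variable {B : Type*} [Ring B] [Algebra ℂ B] {Ω : Type*} [Ring Ω] [Algebra ℂ Ω]
  {deg : ℕ → Submodule ℂ Ω} [GradedAlgebra deg] (C : DifferentialCalculus B deg)

/-- The space `Ω^k` of `k`-forms. -/
def Form (_C : DifferentialCalculus B deg) (k : ℕ) : Type _ := ↥(deg k)

variable (k l : ℕ)

instance : AddCommGroup (C.Form k) := inferInstanceAs (AddCommGroup ↥(deg k))

instance : Module ℂ (C.Form k) := inferInstanceAs (Module ℂ ↥(deg k))

/-- The inclusion `Ω^k ⊆ Ω`. -/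
def incl : C.Form k →ₗ[ℂ] Ω := (deg k).subtype

theorem incl_injective : Function.Injective (C.incl k) := Subtype.coe_injective

theorem ofB_mem (b : B) : C.ofB b ∈ deg 0 := by
  rw [← C.range_ofB]
  exact ⟨b, rfl⟩

instance : SMul B (C.Form k) where
  smul b ω := ⟨C.ofB b * C.incl k ω, by
    simpa using SetLike.mul_mem_graded (C.ofB_mem b) (show C.incl k ω ∈ deg k from ω.2)⟩

instance : SMul Bᵐᵒᵖ (C.Form k) where
  smul b ω := ⟨C.incl k ω * C.ofB b.unop, by
    simpa using SetLike.mul_mem_graded (show C.incl k ω ∈ deg k from ω.2) (C.ofB_mem b.unop)⟩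

@[simp] theorem incl_smul (b : B) (ω : C.Form k) :
    C.incl k (b • ω) = C.ofB b * C.incl k ω := rfl

@[simp] theorem incl_op_smul (b : Bᵐᵒᵖ) (ω : C.Form k) :
    C.incl k (b • ω) = C.incl k ω * C.ofB b.unop := rfl

instance : Module B (C.Form k) where
  one_smul ω := C.incl_injective k (by simp)
  mul_smul b c ω := C.incl_injective k (by simp [mul_assoc])
  smul_zero b := C.incl_injective k (by simp)
  smul_add b ω η := C.incl_injective k (by simp [mul_add])
  add_smul b c ω := C.incl_injective k (by simp [add_mul])
  zero_smul ω := C.incl_injective k (by simp)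

instance : Module Bᵐᵒᵖ (C.Form k) where
  one_smul ω := C.incl_injective k (by simp)
  mul_smul b c ω := C.incl_injective k (by simp [mul_assoc])
  smul_zero b := C.incl_injective k (by simp)
  smul_add b ω η := C.incl_injective k (by simp [add_mul])
  add_smul b c ω := C.incl_injective k (by simp [mul_add])
  zero_smul ω := C.incl_injective k (by simp)

instance : IsScalarTower ℂ B (C.Form k) where
  smul_assoc z b ω := C.incl_injective k (by simp)

instance : IsScalarTower ℂ Bᵐᵒᵖ (C.Form k) where
  smul_assoc z b ω := C.incl_injective k (by simp)

instance : SMulCommClass B Bᵐᵒᵖ (C.Form k) where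
  smul_comm b c ω := C.incl_injective k (by simp [mul_assoc])

/-- The multiplication `Ω^k × Ω^l → Ω^(k+l)`. -/
def mulForm : C.Form k →ₗ[ℂ] C.Form l →ₗ[ℂ] C.Form (k + l) :=
  LinearMap.mk₂ ℂ
    (fun ω η => ⟨C.incl k ω * C.incl l η, SetLike.mul_mem_graded ω.2 η.2⟩)
    (fun _ _ _ => Subtype.ext (add_mul _ _ _))
    (fun _ _ _ => Subtype.ext (smul_mul_assoc _ _ _))
    (fun _ _ _ => Subtype.ext (mul_add _ _ _))
    (fun _ _ _ => Subtype.ext (mul_smul_comm _ _ _))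

@[simp] theorem incl_mulForm (ω : C.Form k) (η : C.Form l) :
    C.incl (k + l) (C.mulForm k l ω η) = C.incl k ω * C.incl l η := rfl

/-- The map `∧ : Ω^k ⊗_B Ω^l → Ω^(k+l)`. -/
def wedge : BTensor B (C.Form k) (C.Form l) →ₗ[ℂ] C.Form (k + l) :=
  BTensor.lift B (C.mulForm k l) fun ω b η =>
    C.incl_injective (k + l) (by simp [mul_assoc])

/-- The differential `d : Ω^k → Ω^(k+1)`. -/
def dForm : C.Form k →ₗ[ℂ] C.Form (k + 1) :=
  (C.d.comp (deg k).subtype).codRestrict (deg (k + 1)) fun ω => C.d_mem k ω ω.2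

/-- The identification `B → Ω^0`. -/
def ofBForm : B →ₗ[ℂ] C.Form 0 :=
  C.ofB.toLinearMap.codRestrict (deg 0) C.ofB_mem

section Covariant

variable (A : Type*) [Ring A] [Bialgebra ℂ A] [LeftComoduleAlgebra A B]
  [∀ k, LeftComodule A (C.Form k)] [∀ k, IsRelHopfBimodule A B (C.Form k)]

/-- Covariance of a calculus whose spaces of forms are objects of `^A_B Mod_B`: `Ω^0` is `B` as a
comodule, `∧` is a morphism of `^A_B Mod_B`, and `d` is `A`-covariant. -/
structure IsCovariant : Prop where
  ofB_covariant : IsCovariantMap A C.ofBForm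
  wedge_morphism : ∀ k l, IsRelHopfMorphism A B (C.wedge k l)
  d_covariant : ∀ k, IsCovariantMap A (C.dForm k)

/-- There is a morphism `s : Ω^2 → Ω^1 ⊗_B Ω^1` of `^A_B Mod_B` with `∧ ∘ s = id`. -/
def IsCovariantlyQuasiTame : Prop :=
  ∃ s : C.Form 2 →ₗ[ℂ] BTensor B (C.Form 1) (C.Form 1),
    IsRelHopfMorphism A B s ∧ C.wedge 1 1 ∘ₗ s = LinearMap.id

end Covariant

end DifferentialCalculus

/-! ### Quantum homogeneous spaces -/

section Homogeneous

variable {A H : Type*} [Ring A] [HopfAlgebra ℂ A] [Ring H] [HopfAlgebra ℂ H]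

/-- The right `H`-coaction `(id ⊗ π) ∘ Δ` on `A`. -/
def rightCoaction (π : A →ₐc[ℂ] H) : A →ₐ[ℂ] A ⊗[ℂ] H :=
  (Algebra.TensorProduct.map (AlgHom.id ℂ A) (π : A →ₐ[ℂ] H)).comp (Bialgebra.comulAlgHom ℂ A)

/-- The coinvariant subalgebra `A^co(H) = {a | (id ⊗ π) (Δ a) = a ⊗ 1}`. -/
def coinvariants (π : A →ₐc[ℂ] H) : Subalgebra ℂ A :=
  AlgHom.equalizer (rightCoaction π) Algebra.TensorProduct.includeLeft

theorem mem_coinvariants (π : A →ₐc[ℂ] H) (a : A) :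
    a ∈ coinvariants π ↔ (π : A →ₗ[ℂ] H).lTensor A (Coalgebra.comul (R := ℂ) a) = a ⊗ₜ 1 :=
  Iff.rfl

/-- The map `A ⊗ A^co(H) → A ⊗ A`. -/
def coinvIncl (π : A →ₐc[ℂ] H) : A ⊗[ℂ] coinvariants π →ₗ[ℂ] A ⊗[ℂ] A :=
  (coinvariants π).val.toLinearMap.lTensor A

theorem coinvIncl_injective (π : A →ₐc[ℂ] H) : Function.Injective (coinvIncl π) :=
  Module.Flat.lTensor_preserves_injective_linearMap _ Subtype.coe_injective

theorem assoc_rTensor_lTensor (A : Type*) [AddCommGroup A] [Module ℂ A] {X Y : Type*}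
    [AddCommGroup X] [Module ℂ X] [AddCommGroup Y] [Module ℂ Y]
    (f : X →ₗ[ℂ] Y) (g : A →ₗ[ℂ] A ⊗[ℂ] A) (x : A ⊗[ℂ] X) :
    TensorProduct.assoc ℂ A A Y (g.rTensor Y (f.lTensor A x)) =
      (f.lTensor A).lTensor A (TensorProduct.assoc ℂ A A X (g.rTensor X x)) := by
  induction x with
  | zero => simp
  | add x y hx hy => simp only [map_add, hx, hy]
  | tmul a x =>
    simp only [LinearMap.lTensor_tmul, LinearMap.rTensor_tmul]
    generalize g a = p
    induction p with
    | zero => simp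
    | add p q hp hq => simp only [TensorProduct.add_tmul, map_add, hp, hq]
    | tmul a a' => simp

/-- The coproduct of `A` maps the coinvariants `B` into `A ⊗ B`. -/
theorem comul_mem_range (π : A →ₐc[ℂ] H) (b : coinvariants π) :
    Coalgebra.comul (R := ℂ) (b : A) ∈ LinearMap.range (coinvIncl π) := by
  let φ : A →ₗ[ℂ] A ⊗[ℂ] H :=
    (π : A →ₗ[ℂ] H).lTensor A ∘ₗ Coalgebra.comul - (TensorProduct.mk ℂ A H).flip 1
  have hex : Function.Exact (coinvariants π).val.toLinearMap φ := by
    intro a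
    rw [LinearMap.sub_apply, sub_eq_zero]
    exact ⟨fun h => ⟨⟨a, h⟩, rfl⟩, fun ⟨c, hc⟩ => hc ▸ c.2⟩
  refine (Module.Flat.lTensor_exact A hex _).1 ?_
  have hb : (π : A →ₗ[ℂ] H).lTensor A (Coalgebra.comul (R := ℂ) (b : A)) = (b : A) ⊗ₜ 1 := b.2
  have h1 := assoc_rTensor_lTensor A (π : A →ₗ[ℂ] H) Coalgebra.comul
    (Coalgebra.comul (R := ℂ) (b : A))
  rw [hb, LinearMap.rTensor_tmul, Coalgebra.coassoc_apply] at h1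
  rw [LinearMap.lTensor_sub, LinearMap.sub_apply, sub_eq_zero, LinearMap.lTensor_comp,
    LinearMap.comp_apply, ← h1]
  generalize Coalgebra.comul (R := ℂ) (b : A) = x
  induction x with
  | zero => simp
  | add x y hx hy => simp only [TensorProduct.add_tmul, map_add, hx, hy]
  | tmul a a' => simp

/-- The coaction `Δ|_B : B → A ⊗ B`. -/
def coinvCoact (π : A →ₐc[ℂ] H) : coinvariants π →ₗ[ℂ] A ⊗[ℂ] coinvariants π :=
  (LinearEquiv.ofInjective (coinvIncl π) (coinvIncl_injective π)).symm.toLinearMap.comp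
    ((Coalgebra.comul.comp (coinvariants π).val.toLinearMap).codRestrict
      (LinearMap.range (coinvIncl π)) (comul_mem_range π))

theorem coinvIncl_coinvCoact (π : A →ₐc[ℂ] H) (b : coinvariants π) :
    coinvIncl π (coinvCoact π b) = Coalgebra.comul (R := ℂ) (b : A) :=
  congrArg Subtype.val (LinearEquiv.apply_symm_apply
    (LinearEquiv.ofInjective (coinvIncl π) (coinvIncl_injective π)) _)

/-- `B = A^co(H)` is a left `A`-comodule algebra with the restriction of `Δ`. -/
instance (π : A →ₐc[ℂ] H) : LeftComoduleAlgebra A (coinvariants π) where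
  coact := coinvCoact π
  coassoc b := by
    have hinj : Function.Injective ((coinvIncl π).lTensor A) :=
      Module.Flat.lTensor_preserves_injective_linearMap _ (coinvIncl_injective π)
    apply hinj
    have hc : coinvIncl π ∘ₗ coinvCoact π =
        Coalgebra.comul ∘ₗ (coinvariants π).val.toLinearMap :=
      LinearMap.ext (coinvIncl_coinvCoact π)
    have hr : (coinvIncl π).lTensor A ((coinvCoact π).lTensor A (coinvCoact π b)) =
        Coalgebra.comul.lTensor A (coinvIncl π (coinvCoact π b)) := by
      rw [← LinearMap.comp_apply, ← LinearMap.lTensor_comp, hc, LinearMap.lTensor_comp,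
        LinearMap.comp_apply]
      rfl
    rw [hr, coinvIncl_coinvCoact, coinvIncl, ← assoc_rTensor_lTensor]
    change TensorProduct.assoc ℂ A A A
      (Coalgebra.comul.rTensor A (coinvIncl π (coinvCoact π b))) = _
    rw [coinvIncl_coinvCoact, Coalgebra.coassoc_apply]
  counit b := by
    have hinj : Function.Injective ((coinvariants π).val.toLinearMap.lTensor ℂ) :=
      Module.Flat.lTensor_preserves_injective_linearMap _ Subtype.coe_injective
    apply hinj
    rw [← LinearMap.comp_apply, LinearMap.lTensor_comp_rTensor, ← LinearMap.rTensor_comp_lTensor,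
      LinearMap.comp_apply]
    change Coalgebra.counit.rTensor A (coinvIncl π (coinvCoact π b)) = _
    rw [coinvIncl_coinvCoact, Coalgebra.rTensor_counit_comul]
    rfl
  coact_one := coinvIncl_injective π <| by
    rw [coinvIncl_coinvCoact]
    simp [coinvIncl, Algebra.TensorProduct.one_def]
  coact_mul b c := coinvIncl_injective π <| by
    have h : ∀ x y, coinvIncl π (x * y) = coinvIncl π x * coinvIncl π y :=
      map_mul (Algebra.TensorProduct.map (AlgHom.id ℂ A) (coinvariants π).val)
    rw [h]
    simp only [coinvIncl_coinvCoact]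
    simp

/-- The right multiplication action of `A^co(H)` on `A`. -/
instance (π : A →ₐc[ℂ] H) : Module (coinvariants π)ᵐᵒᵖ A :=
  Module.compHom A ((coinvariants π).val.toRingHom.op)

end Homogeneous

/-- `P` is faithfully flat as a right `B`-module: a sequence of left `B`-modules is exact if and
only if it becomes exact after applying `P ⊗_B -`. -/
def IsRightFaithfullyFlat (B P : Type u) [Ring B] [Algebra ℂ B]
    [AddCommGroup P] [Module ℂ P] [Module Bᵐᵒᵖ P] : Prop :=
  ∀ (L M N : Type u) [AddCommGroup L] [Module ℂ L] [Module B L] [IsScalarTower ℂ B L]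
    [AddCommGroup M] [Module ℂ M] [Module B M] [IsScalarTower ℂ B M]
    [AddCommGroup N] [Module ℂ N] [Module B N] [IsScalarTower ℂ B N]
    (f : L →ₗ[B] M) (g : M →ₗ[B] N),
    Function.Exact f g ↔
      Function.Exact (BTensor.lTensor B P f) (BTensor.lTensor B P g)

/-- `B = A^co(H)` is a quantum homogeneous space of `A`, where `π : A → H` is a surjective
homomorphism of Hopf algebras. -/
structure IsQuantumHomogeneousSpace {A H : Type u} [Ring A] [HopfAlgebra ℂ A]
    [Ring H] [HopfAlgebra ℂ H] (π : A →ₐc[ℂ] H) : Prop where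
  surjective : Function.Surjective π
  faithfullyFlat : IsRightFaithfullyFlat (coinvariants π) A

/-- `M` lies in `^A_B Mod_0`: it is finitely generated as a left `B`-module and `M B⁺ = B⁺ M`,
where `B⁺ = B ∩ ker ε`. -/
structure IsModZero {A H : Type*} [Ring A] [HopfAlgebra ℂ A] [Ring H] [HopfAlgebra ℂ H]
    (π : A →ₐc[ℂ] H) (M : Type*) [AddCommGroup M] [Module ℂ M]
    [Module (coinvariants π) M] [Module (coinvariants π)ᵐᵒᵖ M] : Prop where
  finite : Module.Finite (coinvariants π) M
  comm : Submodule.span ℂ {x : M | ∃ (m : M) (b : coinvariants π),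
        Coalgebra.counit (R := ℂ) (b : A) = 0 ∧ x = MulOpposite.op b • m} =
      Submodule.span ℂ {x : M | ∃ (b : coinvariants π) (m : M),
        Coalgebra.counit (R := ℂ) (b : A) = 0 ∧ x = b • m}

/-! ### Cosemisimple coalgebras -/

/-- `D ⊆ H` is a subcoalgebra: `Δ D ⊆ D ⊗ D`. -/
def IsSubcoalgebra {H : Type*} [AddCommGroup H] [Module ℂ H] [Coalgebra ℂ H]
    (D : Submodule ℂ H) : Prop :=
  ∀ x ∈ D, Coalgebra.comul (R := ℂ) x ∈ LinearMap.range (TensorProduct.map D.subtype D.subtype)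

/-- A nonzero subcoalgebra without proper nonzero subcoalgebras. -/
structure IsSimpleSubcoalgebra {H : Type*} [AddCommGroup H] [Module ℂ H] [Coalgebra ℂ H]
    (D : Submodule ℂ H) : Prop where
  isSubcoalgebra : IsSubcoalgebra D
  ne_bot : D ≠ ⊥
  eq_bot_or_eq : ∀ E : Submodule ℂ H, IsSubcoalgebra E → E ≤ D → E = ⊥ ∨ E = D

/-- `H` is cosemisimple: it is a direct sum of simple subcoalgebras. -/
def IsCosemisimple (H : Type u) [AddCommGroup H] [Module ℂ H] [Coalgebra ℂ H] : Prop :=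
  ∃ (ι : Type u) (D : ι → Submodule ℂ H),
    (∀ i, IsSimpleSubcoalgebra (D i)) ∧ iSupIndep D ∧ ⨆ i, D i = ⊤

end QHS

end

open QHS

open scoped TensorProduct

noncomputable section

namespace QHS

/-! The argument is of Maschke type: a merely linear splitting is averaged into a covariant bimodule
splitting. Write `ε`, `S` for the counit and antipode of `A`.

Cosemisimplicity of `H` gives a Haar functional `h` (`IsCosemisimple.exists_haar`). Integrating over
the "fibre" yields a conditional expectation `E : A → B`, `E(a) = a₍₁₎ h(π(a₍₂₎))`
(`exists_isExpectation`).

For a relative Hopf bimodule `M`, the map `a ⊗ m ↦ E(a S(m₍₋₁₎)) m₍₀₎` (`averaging`) kills `A ⊗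
B⁺M`, so it descends to `A ⊗ M/B⁺M`. There it is left `B`-linear and `A`-colinear for the structures
on the factor `A`, and right `B`-linear once `MB⁺ ⊆ B⁺M`. Since `m ↦ m₍₋₁₎ ⊗ [m₍₀₎]` is a section of
it, `M` is a retract of `A ⊗ M/B⁺M`.

Hence a surjective morphism `f : M → N` splits (`IsExpectation.exists_section`): lift `N/B⁺N`
linearly to `M` through `f`, call the result `T : N → M`, and set `s(n) = averaging(n₍₋₁₎ ⊗ T
n₍₀₎)`. This is applied to `∧ : Ω¹ ⊗_B Ω¹ → Ω²`, which is surjective because `B` and `dB` generate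
the calculus, while `MB⁺ ⊆ B⁺M` passes from `Ω¹` to `Ω¹ ⊗_B Ω¹`. -/

/-! ### The antipode and the coproduct -/

section Antipode

open WithConv Coalgebra

variable {A : Type*} [Ring A] [HopfAlgebra ℂ A]

/-- `Δ(S a₍₁₎) (a₍₂₎ ⊗ 1) = 1 ⊗ S a`. -/
theorem comul_antipode_mul_tmul_one (a : A) :
    LinearMap.mul' ℂ (A ⊗[ℂ] A) (TensorProduct.map (comul ∘ₗ HopfAlgebra.antipode ℂ)
      ((TensorProduct.mk ℂ A A).flip 1) (comul (R := ℂ) a)) =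
      1 ⊗ₜ HopfAlgebra.antipode ℂ a := by
  -- In the convolution algebra `Hom(A, A ⊗ A)`, `Δ ∘ S` is a left inverse of `Δ`, because `Δ` is an
  -- algebra map.
  have hF : toConv (comul ∘ₗ HopfAlgebra.antipode ℂ (A := A)) *
      toConv (comul (R := ℂ) (A := A)) = 1 := by
    have h := LinearMap.algHom_comp_convMul_distrib (Bialgebra.comulAlgHom ℂ A)
      (toConv (HopfAlgebra.antipode ℂ (A := A))) (toConv LinearMap.id)
    rw [LinearMap.antipode_mul_id] at h
    refine (WithConv.ext h).symm.trans (WithConv.ext (LinearMap.ext fun x => ?_))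
    exact AlgHom.commutes (Bialgebra.comulAlgHom ℂ A) _
  -- This is `a ⊗ 1 = a₍₁₎ ⊗ a₍₂₎ S(a₍₃₎)`. Convolving on the left with `Δ ∘ S` then cancels the
  -- factor `Δ`.
  have hJ : toConv ((TensorProduct.mk ℂ A A).flip 1) = toConv (comul (R := ℂ) (A := A)) *
      toConv (TensorProduct.mk ℂ A A 1 ∘ₗ HopfAlgebra.antipode ℂ) := by
    refine WithConv.ext (LinearMap.ext fun x => ?_)
    change x ⊗ₜ 1 = LinearMap.mul' ℂ _ (TensorProduct.map comul
      (TensorProduct.mk ℂ A A 1 ∘ₗ HopfAlgebra.antipode ℂ) (comul x))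
    have h : ∀ y : A ⊗[ℂ] A, LinearMap.mul' ℂ _ (TensorProduct.map comul
        (TensorProduct.mk ℂ A A 1 ∘ₗ HopfAlgebra.antipode ℂ) y) =
        (LinearMap.mul' ℂ A ∘ₗ (HopfAlgebra.antipode ℂ).lTensor A).lTensor A
          (TensorProduct.assoc ℂ A A A (comul.rTensor A y)) := by
      intro y
      induction y with
      | zero => simp
      | add y z hy hz => simp only [map_add, hy, hz]
      | tmul y z =>
        simp only [TensorProduct.map_tmul, LinearMap.mul'_apply, LinearMap.rTensor_tmul]
        generalize comul (R := ℂ) y = t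
        induction t with
        | zero => simp
        | add s t hs ht => simp only [add_mul, TensorProduct.add_tmul, map_add, hs, ht]
        | tmul s t => simp
    rw [h, coassoc_apply, ← LinearMap.comp_apply, ← LinearMap.lTensor_comp,
      LinearMap.comp_assoc, HopfAlgebra.mul_antipode_lTensor_comul, LinearMap.lTensor_comp,
      LinearMap.comp_apply, lTensor_counit_comul]
    simp
  have hK : toConv (comul ∘ₗ HopfAlgebra.antipode ℂ (A := A)) *
      toConv ((TensorProduct.mk ℂ A A).flip 1) =
      toConv (TensorProduct.mk ℂ A A 1 ∘ₗ HopfAlgebra.antipode ℂ) := by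
    rw [hJ, ← mul_assoc, hF, one_mul]
  exact LinearMap.congr_fun (congrArg WithConv.ofConv hK) a

end Antipode

/-! ### The Haar functional of a cosemisimple Hopf algebra -/

section Haar

theorem eq_of_eqOn_iSup_eq_top {ι V W : Type*} [AddCommGroup V] [Module ℂ V] [AddCommGroup W]
    [Module ℂ W] {D : ι → Submodule ℂ V} (hD : ⨆ i, D i = ⊤) {f g : V →ₗ[ℂ] W}
    (h : ∀ i, ∀ x ∈ D i, f x = g x) (x : V) : f x = g x :=
  (iSup_le (fun i y hy => h i y hy) : ⨆ i, D i ≤ LinearMap.eqLocus f g)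
    (hD ▸ Submodule.mem_top)

variable {H : Type u} [Ring H] [HopfAlgebra ℂ H]

/-- On a cosemisimple Hopf algebra there is a normalized functional `h` with
`x₍₁₎ h(x₍₂₎) = h(x) 1`. -/
theorem IsCosemisimple.exists_haar (hcs : IsCosemisimple H) :
    ∃ h : H →ₗ[ℂ] ℂ, h 1 = 1 ∧
      ∀ x, h.lTensor H (Coalgebra.comul (R := ℂ) x) = (1 : H) ⊗ₜ h x := by
  classical
  obtain ⟨ι, D, hD, hind, htop⟩ := hcs
  have hint := DirectSum.isInternal_submodule_of_iSupIndep_of_iSup_eq_top hind htop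
  let dec := hint.chooseDecomposition
  let p : ι → H →ₗ[ℂ] H := fun i =>
    (D i).subtype ∘ₗ DirectSum.component ℂ ι (fun i => D i) i ∘ₗ
      (DirectSum.decomposeLinearEquiv D).toLinearMap
  have hp : ∀ i x, p i x = DirectSum.decompose D x i := fun _ _ => rfl
  have hp_same : ∀ i, ∀ x ∈ D i, p i x = x := fun i x hx =>
    (hp i x).trans (DirectSum.decompose_of_mem_same D hx)
  have hp_ne : ∀ i j, i ≠ j → ∀ x ∈ D i, p j x = 0 := fun i j hij x hx =>
    (hp j x).trans (DirectSum.decompose_of_mem_ne D hx hij)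
  have hone : (1 : H) ≠ 0 := fun h => by
    simpa using congrArg (Coalgebra.counit (R := ℂ) (A := H)) h
  -- As `Δ D_k ⊆ D_k ⊗ D_k`, the coproduct has no mixed components.
  have hcross : ∀ i j, i ≠ j → ∀ x, TensorProduct.map (p i) (p j)
      (Coalgebra.comul (R := ℂ) x) = 0 := by
    intro i j hij
    refine eq_of_eqOn_iSup_eq_top htop (f := TensorProduct.map (p i) (p j) ∘ₗ Coalgebra.comul)
      (g := 0) fun k x hx => ?_
    obtain ⟨t, ht⟩ := (hD k).isSubcoalgebra x hx
    rw [LinearMap.comp_apply, ← ht]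
    have : TensorProduct.map (p i) (p j) ∘ₗ TensorProduct.map (D k).subtype (D k).subtype = 0 := by
      ext y z
      by_cases hki : k = i
      · simp [hp_ne k j (hki ▸ hij) z z.2]
      · simp [hp_ne k i hki y y.2]
    exact LinearMap.congr_fun this t
  obtain ⟨i, hi⟩ : ∃ i, p i 1 ≠ 0 := by
    by_contra! hall
    refine hone ((DirectSum.decompose D).injective (DFinsupp.ext fun i => Subtype.ext ?_))
    rw [← hp, hall, DirectSum.decompose_zero]
    rfl
  -- Applied to `Δ 1 = 1 ⊗ 1`, the absence of mixed components gives `p i 1 ⊗ p j 1 = 0`. With `p i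
  -- 1 ≠ 0`, all other components of `1` vanish.
  have hone_mem : (1 : H) ∈ D i := by
    have hzero : ∀ j, j ≠ i → p j 1 = 0 := by
      intro j hj
      have h := hcross i j hj.symm 1
      rw [Bialgebra.comul_one, Algebra.TensorProduct.one_def, TensorProduct.map_tmul] at h
      obtain ⟨φ, hφ⟩ : ∃ φ : Module.Dual ℂ H, φ (p i 1) ≠ 0 := by
        by_contra! hall
        exact hi ((Module.forall_dual_apply_eq_zero_iff ℂ _).1 hall)
      have h' := congrArg (fun t => TensorProduct.lid ℂ H (φ.rTensor H t)) h
      simpa [hφ] using h'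
    have h1 : (1 : H) = p i 1 := by
      refine (DirectSum.decompose D).injective (DFinsupp.ext fun j => Subtype.ext ?_)
      rw [← hp, ← hp]
      by_cases hj : j = i
      · subst hj
        exact (hp_same j _ (DirectSum.decompose D 1 j).2).symm
      · rw [hzero j hj]
        exact (hp_ne i j (Ne.symm hj) _ (DirectSum.decompose D 1 i).2).symm
    rw [h1]
    exact (DirectSum.decompose D 1 i).2
  -- The line `ℂ 1` is a nonzero subcoalgebra of the simple `D i`.
  have hspan : Submodule.span ℂ {(1 : H)} = D i := by
    refine ((hD i).eq_bot_or_eq _ (fun x hx => ?_) ?_).resolve_left ?_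
    · obtain ⟨z, rfl⟩ := Submodule.mem_span_singleton.1 hx
      let e : Submodule.span ℂ {(1 : H)} := ⟨1, Submodule.mem_span_singleton_self 1⟩
      exact ⟨z • e ⊗ₜ e, by simp [e, Algebra.TensorProduct.one_def]⟩
    · exact (Submodule.span_singleton_le_iff_mem _ _).2 hone_mem
    · rwa [Submodule.span_singleton_eq_bot]
  -- The Haar functional is the coordinate along the trivial summand `ℂ 1`. Invariance is immediate
  -- on `ℂ 1`; on `D k` with `k ≠ i` both sides vanish, since `Δ D_k ⊆ D_k ⊗ D_k`.
  refine ⟨Coalgebra.counit ∘ₗ p i, by simp [hp_same i 1 hone_mem], ?_⟩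
  refine eq_of_eqOn_iSup_eq_top htop (f := (Coalgebra.counit ∘ₗ p i).lTensor H ∘ₗ Coalgebra.comul)
    (g := TensorProduct.mk ℂ H ℂ 1 ∘ₗ Coalgebra.counit ∘ₗ p i) fun k x hx => ?_
  by_cases hki : k = i
  · subst hki
    rw [← hspan] at hx
    obtain ⟨z, rfl⟩ := Submodule.mem_span_singleton.1 hx
    simp [hp_same k 1 hone_mem, Algebra.TensorProduct.one_def]
  · obtain ⟨t, ht⟩ := (hD k).isSubcoalgebra x hx
    have : (Coalgebra.counit ∘ₗ p i).lTensor H ∘ₗ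
        TensorProduct.map (D k).subtype (D k).subtype = 0 := by
      ext y z
      simp [hp_ne k i hki z z.2]
    rw [LinearMap.comp_apply, ← ht, LinearMap.comp_apply, LinearMap.comp_apply,
      hp_ne k i hki x hx, map_zero, map_zero]
    exact LinearMap.congr_fun this t

end Haar

/-! ### The conditional expectation onto the coinvariants -/

section Expectation

variable {A H : Type u} [Ring A] [HopfAlgebra ℂ A] [Ring H] [HopfAlgebra ℂ H]

/-- A conditional expectation of a left `A`-comodule algebra `B` embedded in `A` by `ι`: a
`B`-bilinear `A`-colinear unital map `E : A → B`. -/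
structure IsExpectation {A B : Type*} [Ring A] [Bialgebra ℂ A] [Ring B] [Algebra ℂ B]
    [LeftComoduleAlgebra A B] (ι : B →ₐ[ℂ] A) (E : A →ₗ[ℂ] B) : Prop where
  comul_incl : ∀ b, Coalgebra.comul (R := ℂ) (ι b) = ι.toLinearMap.lTensor A (coaction A B b)
  map_one : E 1 = 1
  map_mul_left : ∀ b a, E (ι b * a) = b * E a
  map_mul_right : ∀ a b, E (a * ι b) = E a * b
  coaction_map : ∀ a, coaction A B (E a) = E.lTensor A (Coalgebra.comul (R := ℂ) a)

/-- If `h` is a normalized functional with `x₍₁₎ h(x₍₂₎) = h(x) 1`, then `a ↦ a₍₁₎ h(π(a₍₂₎))` is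
a conditional expectation of `A` onto the coinvariants. -/
theorem exists_isExpectation (π : A →ₐc[ℂ] H) (h : H →ₗ[ℂ] ℂ) (h_one : h 1 = 1)
    (h_inv : ∀ x, h.lTensor H (Coalgebra.comul (R := ℂ) x) = (1 : H) ⊗ₜ h x) :
    ∃ E : A →ₗ[ℂ] coinvariants π, IsExpectation (coinvariants π).val E := by
  let q : A ⊗[ℂ] H →ₗ[ℂ] A := TensorProduct.rid ℂ A ∘ₗ h.lTensor A
  have hq : ∀ a x, q (a ⊗ₜ x) = h x • a := fun a x => by simp [q]
  let F : A →ₗ[ℂ] A := q ∘ₗ (rightCoaction π).toLinearMap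
  have hF : ∀ a, F a = q (rightCoaction π a) := fun _ => rfl
  -- Left colinearity is coassociativity: `F` only evaluates the last leg of `Δ`.
  have hFcomul : ∀ a, Coalgebra.comul (R := ℂ) (F a) =
      F.lTensor A (Coalgebra.comul (R := ℂ) a) := by
    intro a
    have h1 : ∀ y : A ⊗[ℂ] A, Coalgebra.comul (R := ℂ) (q ((π : A →ₗ[ℂ] H).lTensor A y)) =
        (q ∘ₗ (π : A →ₗ[ℂ] H).lTensor A).lTensor A
          (TensorProduct.assoc ℂ A A A (Coalgebra.comul.rTensor A y)) := by
      intro y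
      induction y with
      | zero => simp
      | add y z hy hz => simp only [map_add, hy, hz]
      | tmul y z =>
        simp only [LinearMap.lTensor_tmul, LinearMap.rTensor_tmul, hq, map_smul]
        generalize Coalgebra.comul (R := ℂ) y = t
        induction t with
        | zero => simp
        | add s t hs ht => simp only [TensorProduct.add_tmul, map_add, smul_add, hs, ht]
        | tmul s t => simp [hq]
    change Coalgebra.comul (R := ℂ) (q ((π : A →ₗ[ℂ] H).lTensor A (Coalgebra.comul a))) =
      ((q ∘ₗ (π : A →ₗ[ℂ] H).lTensor A) ∘ₗ Coalgebra.comul).lTensor A _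
    rw [h1, Coalgebra.coassoc_apply, LinearMap.lTensor_comp A _ Coalgebra.comul, LinearMap.comp_apply]
  have hmem : ∀ a, F a ∈ coinvariants π := by
    intro a
    rw [mem_coinvariants, hFcomul, ← LinearMap.comp_apply, ← LinearMap.lTensor_comp]
    -- Invariance of `h` gives `π(F x) = h(π x) 1`. With colinearity, `(id ⊗ π)Δ(F a) = a₍₁₎ ⊗ h(π
    -- a₍₂₎) 1 = F a ⊗ 1`.
    have h2 : (π : A →ₗ[ℂ] H) ∘ₗ F = LinearMap.toSpanSingleton ℂ H 1 ∘ₗ h ∘ₗ (π : A →ₗ[ℂ] H) := by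
      ext x
      have h3 : ∀ y : A ⊗[ℂ] A, (π : A →ₗ[ℂ] H) (q ((π : A →ₗ[ℂ] H).lTensor A y)) =
          TensorProduct.rid ℂ H (h.lTensor H
            (TensorProduct.map (π : A →ₗ[ℂ] H) (π : A →ₗ[ℂ] H) y)) := by
        intro y
        induction y with
        | zero => simp
        | add y z hy hz => simp only [map_add, hy, hz]
        | tmul y z => simp [hq]
      have h4 : TensorProduct.map (π : A →ₗ[ℂ] H) (π : A →ₗ[ℂ] H) (Coalgebra.comul (R := ℂ) x) =
          Coalgebra.comul (R := ℂ) (π x) := CoalgHomClass.map_comp_comul_apply π x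
      refine (h3 (Coalgebra.comul x)).trans ?_
      rw [h4, h_inv]
      simp
    rw [h2]
    change (LinearMap.toSpanSingleton ℂ H 1 ∘ₗ h ∘ₗ (π : A →ₗ[ℂ] H)).lTensor A _ =
      q ((π : A →ₗ[ℂ] H).lTensor A (Coalgebra.comul (R := ℂ) a)) ⊗ₜ[ℂ] (1 : H)
    generalize Coalgebra.comul (R := ℂ) a = t
    induction t with
    | zero => simp
    | add s t hs ht => simp only [TensorProduct.add_tmul, map_add, hs, ht]
    | tmul s t => simp [hq, TensorProduct.smul_tmul]
  -- The right coaction sends `b ∈ B` to `b ⊗ 1`, so `B`-bilinearity of `F` reduces to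
  -- `A`-bilinearity of `q`.
  have hql : ∀ a t, q ((a ⊗ₜ 1) * t) = a * q t := by
    intro a t
    induction t with
    | zero => simp
    | add s t hs ht => simp only [mul_add, map_add, hs, ht]
    | tmul s t => simp [hq]
  have hqr : ∀ t a, q (t * (a ⊗ₜ 1)) = q t * a := by
    intro t a
    induction t with
    | zero => simp
    | add s t hs ht => simp only [add_mul, map_add, hs, ht]
    | tmul s t => simp [hq]
  have hright : ∀ b : coinvariants π, rightCoaction π b = (b : A) ⊗ₜ 1 := fun b => b.2
  refine ⟨F.codRestrict (Subalgebra.toSubmodule (coinvariants π)) hmem, ?_, ?_, ?_, ?_, ?_⟩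
  · exact fun b => (coinvIncl_coinvCoact π b).symm
  · refine Subtype.ext ?_
    change F 1 = 1
    rw [hF, _root_.map_one, Algebra.TensorProduct.one_def, hq, h_one, one_smul]
  · intro b a
    refine Subtype.ext ?_
    change F (b * a) = b * F a
    rw [hF, _root_.map_mul, hright, hql, hF]
  · intro a b
    refine Subtype.ext ?_
    change F (a * b) = F a * b
    rw [hF, _root_.map_mul, hright, hqr, hF]
  · intro a
    refine coinvIncl_injective π ((coinvIncl_coinvCoact π _).trans ?_)
    refine (hFcomul a).trans ?_
    rw [coinvIncl, ← LinearMap.lTensor_comp_apply]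
    rfl

end Expectation

/-! ### Averaging over a conditional expectation -/

section Averaging

variable {A B : Type*} [Ring A] [HopfAlgebra ℂ A] [Ring B] [Algebra ℂ B]
  [LeftComoduleAlgebra A B] {ι : B →ₐ[ℂ] A} {E : A →ₗ[ℂ] B}

/-- The antipode axiom `S(b₍₁₎) b₍₂₎ = ε(b)`, read through the fact that the coaction on `B`
restricts `Δ`. -/
theorem IsExpectation.antipode_coaction (hE : IsExpectation ι E) (b : B) :
    LinearMap.mul' ℂ A (TensorProduct.map (HopfAlgebra.antipode ℂ) ι.toLinearMap
      (coaction A B b)) = algebraMap ℂ A (Coalgebra.counit (ι b)) := by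
  rw [← HopfAlgebra.mul_antipode_rTensor_comul_apply, hE.comul_incl, ← LinearMap.comp_apply
    ((HopfAlgebra.antipode ℂ).rTensor A), LinearMap.rTensor_comp_lTensor]

/-- Turns a diagonal action of `b` into multiplication by `b` on the factor `A`, whenever the other
factor sees `b₍₀₎` only through `ε`. -/
theorem IsExpectation.rid_counit_coaction (hE : IsExpectation ι E) (b : B) :
    TensorProduct.rid ℂ A ((Coalgebra.counit ∘ₗ ι.toLinearMap).lTensor A (coaction A B b)) =
      ι b := by
  rw [LinearMap.lTensor_comp_apply, ← hE.comul_incl, Coalgebra.lTensor_counit_comul]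
  simp

variable (E) (M N : Type*)
  [AddCommGroup M] [Module ℂ M] [Module B M] [Module Bᵐᵒᵖ M]
  [IsScalarTower ℂ B M] [IsScalarTower ℂ Bᵐᵒᵖ M] [SMulCommClass B Bᵐᵒᵖ M]
  [LeftComodule A M] [IsRelHopfBimodule A B M]
  [AddCommGroup N] [Module ℂ N] [Module B N] [Module Bᵐᵒᵖ N]
  [IsScalarTower ℂ B N] [IsScalarTower ℂ Bᵐᵒᵖ N] [SMulCommClass B Bᵐᵒᵖ N]
  [LeftComodule A N] [IsRelHopfBimodule A B N]

/-- The bilinear map `(a, c ⊗ m) ↦ E(a S(c)) m`. -/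
def antipodeAct : A →ₗ[ℂ] A ⊗[ℂ] M →ₗ[ℂ] M :=
  LinearMap.mk₂ ℂ
    (fun a => TensorProduct.lift (actL B M ∘ₗ E ∘ₗ LinearMap.mulLeft ℂ a ∘ₗ
      HopfAlgebra.antipode ℂ))
    (fun a a' x => by
      induction x with
      | zero => simp
      | add x y hx hy => simp only [map_add, hx, hy]; abel
      | tmul c m => simp [add_mul])
    (fun z a x => by
      induction x with
      | zero => simp
      | add x y hx hy => simp only [map_add, smul_add, hx, hy]
      | tmul c m => simp)
    (fun a x y => map_add _ x y)
    (fun z a x => map_smul _ z x)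

@[simp] theorem antipodeAct_tmul (a c : A) (m : M) :
    antipodeAct E M a (c ⊗ₜ m) = E (a * HopfAlgebra.antipode ℂ c) • m := rfl

/-- The averaging map `a ⊗ m ↦ E(a S(m₍₋₁₎)) m₍₀₎`. -/
def averaging : A ⊗[ℂ] M →ₗ[ℂ] M :=
  TensorProduct.lift ((antipodeAct E M).compl₂ (coaction A M))

@[simp] theorem averaging_tmul (a : A) (m : M) :
    averaging E M (a ⊗ₜ m) = antipodeAct E M a (coaction A M m) := rfl

/-- The span of the elements `b m` with `ε(b) = 0`. -/
def augmentation (ι : B →ₐ[ℂ] A) : Submodule ℂ M :=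
  Submodule.span ℂ {x | ∃ (b : B) (m : M), Coalgebra.counit (R := ℂ) (ι b) = 0 ∧ x = b • m}

variable {M N}

theorem coaction_coassoc {A V : Type*} [AddCommGroup A] [Module ℂ A] [Coalgebra ℂ A]
    [AddCommGroup V] [Module ℂ V] [LeftComodule A V] (v : V) :
    TensorProduct.assoc ℂ A A V
      ((Coalgebra.comul (R := ℂ) (A := A)).rTensor V (coaction A V v)) =
      (coaction A V).lTensor A (coaction A V v) :=
  LeftComodule.coassoc v

theorem lid_counit_coaction {A V : Type*} [AddCommGroup A] [Module ℂ A] [Coalgebra ℂ A]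
    [AddCommGroup V] [Module ℂ V] [LeftComodule A V] (v : V) :
    TensorProduct.lid ℂ V ((Coalgebra.counit (R := ℂ) (A := A)).rTensor V (coaction A V v)) = v :=
  (congrArg _ (LeftComodule.counit v)).trans (by simp)

variable {E}

/-! ### Properties of the averaging map, and splitting of surjections -/

namespace IsExpectation

/-- Right `B`-linearity lets `E` absorb `b₍₀₎`: `E(a S(b₍₋₁₎ c)) b₍₀₎ = E(a S(c) S(b₍₋₁₎) b₍₀₎) =
ε(b) E(a S(c))`. -/
theorem antipodeAct_diagonal (hE : IsExpectation ι E) (a : A) (b : B) (y : A ⊗[ℂ] M) :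
    antipodeAct E M a (diagonal A (actL B M) (coaction A B b) y) =
      Coalgebra.counit (R := ℂ) (ι b) • antipodeAct E M a y := by
  induction y with
  | zero => simp
  | add y z hy hz => simp only [map_add, smul_add, hy, hz]
  | tmul c m =>
    have h : ∀ x : A ⊗[ℂ] B, antipodeAct E M a (diagonal A (actL B M) x (c ⊗ₜ m)) =
        E (a * HopfAlgebra.antipode ℂ c * LinearMap.mul' ℂ A
          (TensorProduct.map (HopfAlgebra.antipode ℂ) ι.toLinearMap x)) • m := by
      intro x
      induction x with
      | zero => simp
      | add x y hx hy => simp only [map_add, LinearMap.add_apply, mul_add, add_smul, hx, hy]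
      | tmul c' b' =>
        simp only [diagonal_tmul, antipodeAct_tmul, actL_apply, TensorProduct.map_tmul,
          LinearMap.mul'_apply, AlgHom.toLinearMap_apply, HopfAlgebra.antipode_mul_antidistrib,
          ← mul_assoc, hE.map_mul_right, mul_smul]
    rw [h, hE.antipode_coaction, Algebra.algebraMap_eq_smul_one, mul_smul_comm, mul_one,
      map_smul, smul_assoc, antipodeAct_tmul]

theorem averaging_tmul_smul (hE : IsExpectation ι E) (a : A) (b : B) (m : M) :
    averaging E M (a ⊗ₜ (b • m)) = Coalgebra.counit (R := ℂ) (ι b) • averaging E M (a ⊗ₜ m) := by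
  rw [averaging_tmul, IsRelHopfBimodule.coaction_smul, hE.antipodeAct_diagonal, averaging_tmul]

/-- This is what lets the averaging map descend to `A ⊗ M/B⁺M`, so that arbitrary linear lifts
modulo `B⁺M` may be fed into it. -/
theorem averaging_tmul_of_mem (hE : IsExpectation ι E) (a : A) {m : M} (hm : m ∈ augmentation M ι) :
    averaging E M (a ⊗ₜ m) = 0 := by
  induction hm using Submodule.span_induction with
  | mem x hx =>
    obtain ⟨b, m, hb, rfl⟩ := hx
    rw [hE.averaging_tmul_smul, hb, zero_smul]
  | zero => simp
  | add x y _ _ hx hy => rw [TensorProduct.tmul_add, map_add, hx, hy, add_zero]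
  | smul z x _ hx => rw [TensorProduct.tmul_smul, map_smul, hx, smul_zero]

theorem averaging_mulLeft (hE : IsExpectation ι E) (b : B) (t : A ⊗[ℂ] M) :
    averaging E M ((LinearMap.mulLeft ℂ (ι b)).rTensor M t) = b • averaging E M t := by
  induction t with
  | zero => simp
  | add s t hs ht => simp only [map_add, smul_add, hs, ht]
  | tmul a m =>
    simp only [LinearMap.rTensor_tmul, LinearMap.mulLeft_apply, averaging_tmul]
    generalize coaction A M m = y
    induction y with
    | zero => simp
    | add y z hy hz => simp only [map_add, smul_add, hy, hz]
    | tmul c m => simp [mul_assoc, hE.map_mul_left, mul_smul]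

/-- By coassociativity the value is `E(m₍₋₂₎ S(m₍₋₁₎)) m₍₀₎`, which collapses to `E(1) m = m`. -/
theorem averaging_coaction (hE : IsExpectation ι E) (m : M) : averaging E M (coaction A M m) = m := by
  have h : ∀ y : A ⊗[ℂ] M, TensorProduct.lift (antipodeAct E M)
      (TensorProduct.assoc ℂ A A M (Coalgebra.comul.rTensor M y)) =
      TensorProduct.lid ℂ M (Coalgebra.counit.rTensor M y) := by
    intro y
    induction y with
    | zero => simp
    | add y z hy hz => simp only [map_add, hy, hz]
    | tmul c m =>
      have h' : ∀ t : A ⊗[ℂ] A, TensorProduct.lift (antipodeAct E M)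
          (TensorProduct.assoc ℂ A A M (t ⊗ₜ m)) =
          E (LinearMap.mul' ℂ A ((HopfAlgebra.antipode ℂ).lTensor A t)) • m := by
        intro t
        induction t with
        | zero => simp
        | add s t hs ht => simp only [TensorProduct.add_tmul, map_add, add_smul, hs, ht]
        | tmul s t => simp
      rw [LinearMap.rTensor_tmul, h', HopfAlgebra.mul_antipode_lTensor_comul_apply,
        Algebra.algebraMap_eq_smul_one, map_smul, hE.map_one]
      simp
  have h2 : averaging E M = TensorProduct.lift (antipodeAct E M) ∘ₗ (coaction A M).lTensor A := by
    ext a m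
    simp
  rw [h2, LinearMap.comp_apply, ← coaction_coassoc, h, lid_counit_coaction]

/-- Only the coaction on the factor `A` survives: `S(m₍₋₁₎)` cancels the coaction of `m₍₀₎`. -/
theorem coaction_averaging (hE : IsExpectation ι E) (t : A ⊗[ℂ] M) :
    coaction A M (averaging E M t) = (averaging E M).lTensor A
      (TensorProduct.assoc ℂ A A M (Coalgebra.comul.rTensor M t)) := by
  induction t with
  | zero => simp
  | add s t hs ht => simp only [map_add, hs, ht]
  | tmul a m =>
    let G : A →ₗ[ℂ] A ⊗[ℂ] M →ₗ[ℂ] A ⊗[ℂ] M :=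
      diagonal A (actL B M) ∘ₗ E.lTensor A ∘ₗ Coalgebra.comul ∘ₗ LinearMap.mulLeft ℂ a ∘ₗ
        HopfAlgebra.antipode ℂ
    have h1 : ∀ y : A ⊗[ℂ] M, coaction A M (antipodeAct E M a y) =
        TensorProduct.lift G ((coaction A M).lTensor A y) := by
      intro y
      induction y with
      | zero => simp
      | add y z hy hz => simp only [map_add, hy, hz]
      | tmul c m => simp [G, IsRelHopfBimodule.coaction_smul, hE.coaction_map]
    let Q : M → A ⊗[ℂ] A →ₗ[ℂ] A ⊗[ℂ] M := fun m => ((actL B M).flip m ∘ₗ E).lTensor A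
    -- The cancellation: `S(c₍₁₎)₍₁₎ c₍₂₎ ⊗ S(c₍₁₎)₍₂₎ = 1 ⊗ S(c)`.
    have h2 : ∀ (c : A) (m : M), TensorProduct.lift G
        (TensorProduct.assoc ℂ A A M (Coalgebra.comul.rTensor M (c ⊗ₜ m))) =
        Q m (Coalgebra.comul (R := ℂ) a * (1 ⊗ₜ HopfAlgebra.antipode ℂ c)) := by
      intro c m
      rw [← comul_antipode_mul_tmul_one, LinearMap.rTensor_tmul]
      generalize Coalgebra.comul (R := ℂ) c = t
      induction t with
      | zero => simp
      | add s t hs ht => simp only [TensorProduct.add_tmul, map_add, mul_add, hs, ht]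
      | tmul s t =>
        simp only [TensorProduct.assoc_tmul, TensorProduct.lift.tmul, G, LinearMap.comp_apply,
          LinearMap.mulLeft_apply, TensorProduct.map_tmul, LinearMap.mul'_apply,
          LinearMap.flip_apply, TensorProduct.mk_apply, Bialgebra.comul_mul, ← mul_assoc]
        generalize Coalgebra.comul (R := ℂ) a * Coalgebra.comul (HopfAlgebra.antipode ℂ s) = x
        induction x with
        | zero => simp
        | add x y hx hy => simp only [map_add, LinearMap.add_apply, add_mul, hx, hy]
        | tmul x y => simp [Q]
    have h3 : ∀ y : A ⊗[ℂ] M, TensorProduct.lift G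
        (TensorProduct.assoc ℂ A A M (Coalgebra.comul.rTensor M y)) =
        ((antipodeAct E M).flip y).lTensor A (Coalgebra.comul a) := by
      intro y
      induction y with
      | zero => simp
      | add y z hy hz => simp only [map_add, LinearMap.lTensor_add, LinearMap.add_apply, hy, hz]
      | tmul c m =>
        rw [h2]
        generalize Coalgebra.comul (R := ℂ) a = x
        induction x with
        | zero => simp
        | add x y hx hy => simp only [map_add, add_mul, hx, hy]
        | tmul x y => simp [Q]
    rw [averaging_tmul, h1, ← coaction_coassoc, h3, LinearMap.rTensor_tmul]
    generalize Coalgebra.comul (R := ℂ) a = x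
    induction x with
    | zero => simp
    | add x y hx hy => simp only [TensorProduct.add_tmul, map_add, hx, hy]
    | tmul x y => simp

/-- Here `S(m₍₋₁₎ b₍₋₁₎) = S(b₍₋₁₎) S(m₍₋₁₎)`, so the inner `b₍₋₂₎ S(b₍₋₁₎)` cancels and leaves `b`
acting on the right of `m₍₀₎`. -/
theorem averaging_diagonal (a : A) (m : M) (b : B) :
    averaging E M (diagonal A (actR B M) (a ⊗ₜ m) (coaction A B b)) =
      MulOpposite.op b • averaging E M (a ⊗ₜ m) := by
  have h1 : ∀ x : A ⊗[ℂ] B, averaging E M (diagonal A (actR B M) (a ⊗ₜ m) x) =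
      TensorProduct.lift ((antipodeAct E M ∘ₗ LinearMap.mulLeft ℂ a).compl₂
        (diagonal A (actR B M) (coaction A M m))) ((coaction A B).lTensor A x) := by
    intro x
    induction x with
    | zero => simp
    | add x y hx hy => simp only [map_add, hx, hy]
    | tmul c b => simp [IsRelHopfBimodule.coaction_op_smul]
  rw [h1, ← coaction_coassoc, averaging_tmul]
  generalize coaction A M m = y
  have h2 : ∀ x : A ⊗[ℂ] B, TensorProduct.lift ((antipodeAct E M ∘ₗ LinearMap.mulLeft ℂ a).compl₂
        (diagonal A (actR B M) y)) (TensorProduct.assoc ℂ A A B (Coalgebra.comul.rTensor B x)) =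
      MulOpposite.op (TensorProduct.lid ℂ B (Coalgebra.counit.rTensor B x)) •
        antipodeAct E M a y := by
    intro x
    induction x with
    | zero => simp
    | add x x' hx hx' => simp only [map_add, MulOpposite.op_add, add_smul, hx, hx']
    | tmul k b =>
      have h3 : ∀ s t : A, antipodeAct E M (a * s) (diagonal A (actR B M) y (t ⊗ₜ b)) =
          MulOpposite.op b • antipodeAct E M (a * (s * HopfAlgebra.antipode ℂ t)) y := by
        intro s t
        induction y with
        | zero => simp
        | add y z hy hz => simp only [map_add, LinearMap.add_apply, smul_add, hy, hz]
        | tmul c m =>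
          simp [HopfAlgebra.antipode_mul_antidistrib, mul_assoc, smul_comm _ (MulOpposite.op b)]
      have h4 : ∀ t : A ⊗[ℂ] A, TensorProduct.lift
          ((antipodeAct E M ∘ₗ LinearMap.mulLeft ℂ a).compl₂ (diagonal A (actR B M) y))
            (TensorProduct.assoc ℂ A A B (t ⊗ₜ b)) =
          MulOpposite.op b • antipodeAct E M
            (a * LinearMap.mul' ℂ A ((HopfAlgebra.antipode ℂ).lTensor A t)) y := by
        intro t
        induction t with
        | zero => simp
        | add s t hs ht =>
          simp only [TensorProduct.add_tmul, map_add, LinearMap.add_apply, mul_add, smul_add,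
            hs, ht]
        | tmul s t => simp [h3]
      rw [LinearMap.rTensor_tmul, h4, HopfAlgebra.mul_antipode_lTensor_comul_apply]
      simp [Algebra.algebraMap_eq_smul_one, smul_assoc, smul_comm _ (MulOpposite.op b)]
  rw [h2, lid_counit_coaction]

/-- Modulo `B⁺M`, `m b ≡ ε(b) m`. Thus `a b₍₋₁₎ ⊗ m b₍₀₎` and `a b ⊗ m` have the same average, and
`averaging_diagonal` computes the former. -/
theorem averaging_mulRight (hE : IsExpectation ι E)
    (hM : ∀ (b : B) (m : M), Coalgebra.counit (R := ℂ) (ι b) = 0 →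
      MulOpposite.op b • m ∈ augmentation M ι) (b : B) (t : A ⊗[ℂ] M) :
    averaging E M ((LinearMap.mulRight ℂ (ι b)).rTensor M t) =
      MulOpposite.op b • averaging E M t := by
  induction t with
  | zero => simp
  | add s t hs ht => simp only [map_add, smul_add, hs, ht]
  | tmul a m =>
    have h : ∀ x : A ⊗[ℂ] B, averaging E M (diagonal A (actR B M) (a ⊗ₜ m) x) =
        averaging E M ((a * TensorProduct.rid ℂ A
          ((Coalgebra.counit ∘ₗ ι.toLinearMap).lTensor A x)) ⊗ₜ m) := by
      intro x
      induction x with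
      | zero => simp
      | add x y hx hy => simp only [map_add, mul_add, TensorProduct.add_tmul, hx, hy]
      | tmul c b =>
        have h0 := hE.averaging_tmul_of_mem (a * c) (hM
          (b - algebraMap ℂ B (Coalgebra.counit (R := ℂ) (ι b))) m (by simp))
        have h1 : MulOpposite.op (b - algebraMap ℂ B (Coalgebra.counit (R := ℂ) (ι b))) • m =
            MulOpposite.op b • m - Coalgebra.counit (R := ℂ) (ι b) • m := by
          rw [MulOpposite.op_sub, sub_smul, Algebra.algebraMap_eq_smul_one, MulOpposite.op_smul,
            smul_assoc, MulOpposite.op_one, one_smul]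
        rw [h1, TensorProduct.tmul_sub, map_sub, sub_eq_zero] at h0
        rw [diagonal_tmul, actR_apply, h0]
        simp
    rw [← averaging_diagonal, h, hE.rid_counit_coaction]
    rfl

theorem map_averaging {f : M →ₗ[ℂ] N} (hf : IsRelHopfMorphism A B f) (t : A ⊗[ℂ] M) :
    f (averaging E M t) = averaging E N (f.lTensor A t) := by
  induction t with
  | zero => simp
  | add s t hs ht => simp only [map_add, hs, ht]
  | tmul a m =>
    rw [LinearMap.lTensor_tmul, averaging_tmul, averaging_tmul, hf.covariant]
    generalize coaction A M m = y
    induction y with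
    | zero => simp
    | add y z hy hz => simp only [map_add, hy, hz]
    | tmul c m => simp [hf.map_smul]

/-- In the presence of a conditional expectation, a surjective morphism of relative Hopf bimodules
`M` with `M B⁺ ⊆ B⁺ M` splits. -/
theorem exists_section (hE : IsExpectation ι E) {f : M →ₗ[ℂ] N} (hf : IsRelHopfMorphism A B f)
    (hsurj : Function.Surjective f)
    (hM : ∀ (b : B) (m : M), Coalgebra.counit (R := ℂ) (ι b) = 0 →
      MulOpposite.op b • m ∈ augmentation M ι)
    (hN : ∀ (b : B) (n : N), Coalgebra.counit (R := ℂ) (ι b) = 0 →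
      MulOpposite.op b • n ∈ augmentation N ι) :
    ∃ s : N →ₗ[ℂ] M, IsRelHopfMorphism A B s ∧ f ∘ₗ s = LinearMap.id := by
  -- `σ` is a linear section of `M → N → N/B⁺N`. The induced `T` kills `B⁺N` and satisfies `f(T n) ≡
  -- n` modulo `B⁺N`.
  obtain ⟨σ, hσ⟩ := ((augmentation N ι).mkQ ∘ₗ f).exists_rightInverse_of_surjective
    (LinearMap.range_eq_top.2 ((Submodule.mkQ_surjective _).comp hsurj))
  let T : N →ₗ[ℂ] M := σ ∘ₗ (augmentation N ι).mkQ
  have hT_zero : ∀ n ∈ augmentation N ι, T n = 0 := fun n hn => by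
    simp [T, (Submodule.Quotient.mk_eq_zero _).2 hn]
  have hT_sub : ∀ n, f (T n) - n ∈ augmentation N ι := fun n =>
    (Submodule.Quotient.eq _).1 (LinearMap.congr_fun hσ (Submodule.Quotient.mk n))
  have hcounit : ∀ b : B, Coalgebra.counit (R := ℂ)
      (ι (b - algebraMap ℂ B (Coalgebra.counit (R := ℂ) (ι b)))) = 0 := fun b => by simp
  -- Since `b - ε(b) ∈ B⁺`, both actions of `B` become `ε` after `T`; on the right this uses `NB⁺ ⊆
  -- B⁺N`.
  have hT_smul : ∀ (b : B) (n : N), T (b • n) = Coalgebra.counit (R := ℂ) (ι b) • T n := by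
    intro b n
    have h := hT_zero _ (Submodule.subset_span ⟨_, n, hcounit b, rfl⟩)
    rw [sub_smul, map_sub, algebraMap_smul, sub_eq_zero] at h
    exact h.trans (map_smul T _ n)
  have hT_op_smul : ∀ (b : B) (n : N), T (MulOpposite.op b • n) =
      Coalgebra.counit (R := ℂ) (ι b) • T n := by
    intro b n
    have h := hT_zero _ (hN _ n (hcounit b))
    rw [MulOpposite.op_sub, sub_smul, Algebra.algebraMap_eq_smul_one, MulOpposite.op_smul,
      smul_assoc, MulOpposite.op_one, one_smul, map_sub, sub_eq_zero] at h
    exact h.trans (map_smul T _ n)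
  let s : N →ₗ[ℂ] M := averaging E M ∘ₗ T.lTensor A ∘ₗ coaction A N
  have hs : ∀ n, s n = averaging E M (T.lTensor A (coaction A N n)) := fun _ => rfl
  refine ⟨s, ⟨fun b n => ?_, fun b n => ?_, fun n => ?_⟩, LinearMap.ext fun n => ?_⟩
  · have h : ∀ (x : A ⊗[ℂ] B) (y : A ⊗[ℂ] N), T.lTensor A (diagonal A (actL B N) x y) =
        (LinearMap.mulLeft ℂ (TensorProduct.rid ℂ A
          ((Coalgebra.counit ∘ₗ ι.toLinearMap).lTensor A x))).rTensor M (T.lTensor A y) := by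
      intro x y
      induction y with
      | zero => simp
      | add y z hy hz => simp only [map_add, hy, hz]
      | tmul c n =>
        induction x with
        | zero => simp
        | add x x' hx hx' =>
          simp only [map_add, LinearMap.add_apply, LinearMap.rTensor_tmul, LinearMap.lTensor_tmul,
            LinearMap.mulLeft_apply, add_mul, TensorProduct.add_tmul] at hx hx' ⊢
          rw [hx, hx']
        | tmul c' b => simp [hT_smul, TensorProduct.smul_tmul]
    rw [hs, IsRelHopfBimodule.coaction_smul, h, hE.rid_counit_coaction, hE.averaging_mulLeft, hs]
  · have h : ∀ (x : A ⊗[ℂ] B) (y : A ⊗[ℂ] N), T.lTensor A (diagonal A (actR B N) y x) =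
        (LinearMap.mulRight ℂ (TensorProduct.rid ℂ A
          ((Coalgebra.counit ∘ₗ ι.toLinearMap).lTensor A x))).rTensor M (T.lTensor A y) := by
      intro x y
      induction y with
      | zero => simp
      | add y z hy hz => simp only [map_add, LinearMap.add_apply, hy, hz]
      | tmul c n =>
        induction x with
        | zero => simp
        | add x x' hx hx' =>
          simp only [map_add, LinearMap.rTensor_tmul, LinearMap.lTensor_tmul,
            LinearMap.mulRight_apply, mul_add, TensorProduct.add_tmul] at hx hx' ⊢
          rw [hx, hx']
        | tmul c' b => simp [hT_op_smul, TensorProduct.smul_tmul]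
    rw [hs, IsRelHopfBimodule.coaction_op_smul, h, hE.rid_counit_coaction,
      hE.averaging_mulRight hM, hs]
  · rw [hs, hE.coaction_averaging, assoc_rTensor_lTensor, coaction_coassoc,
      ← LinearMap.lTensor_comp_apply, ← LinearMap.lTensor_comp_apply]
    rfl
  · have h : ∀ y : A ⊗[ℂ] N, averaging E N (f.lTensor A (T.lTensor A y)) = averaging E N y := by
      intro y
      induction y with
      | zero => simp
      | add y z hy hz => simp only [map_add, hy, hz]
      | tmul c n =>
        rw [LinearMap.lTensor_tmul, LinearMap.lTensor_tmul, ← sub_eq_zero, ← map_sub,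
          ← TensorProduct.tmul_sub]
        exact hE.averaging_tmul_of_mem c (hT_sub n)
    rw [LinearMap.comp_apply, hs, map_averaging hf, h, hE.averaging_coaction]
    rfl

end IsExpectation

end Averaging

/-! ### The calculus -/

section Calculus

/-- Move `B⁺` leftwards across both factors: `m ⊗ n b` is a sum of terms `m ⊗ c n' = m c ⊗ n'` with
`c ∈ B⁺`, and `m c ∈ B⁺M`. -/
theorem op_smul_bTensor_mem_augmentation {A B : Type*} [Ring A] [HopfAlgebra ℂ A] [Ring B]
    [Algebra ℂ B] (ι : B →ₐ[ℂ] A) (M N : Type*)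
    [AddCommGroup M] [Module ℂ M] [Module B M] [Module Bᵐᵒᵖ M]
    [IsScalarTower ℂ B M] [IsScalarTower ℂ Bᵐᵒᵖ M] [SMulCommClass B Bᵐᵒᵖ M]
    [AddCommGroup N] [Module ℂ N] [Module B N] [Module Bᵐᵒᵖ N]
    [IsScalarTower ℂ B N] [IsScalarTower ℂ Bᵐᵒᵖ N] [SMulCommClass B Bᵐᵒᵖ N]
    (hM : ∀ (b : B) (m : M), Coalgebra.counit (R := ℂ) (ι b) = 0 →
      MulOpposite.op b • m ∈ augmentation M ι)
    (hN : ∀ (b : B) (n : N), Coalgebra.counit (R := ℂ) (ι b) = 0 →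
      MulOpposite.op b • n ∈ augmentation N ι)
    (b : B) (t : BTensor B M N) (hb : Coalgebra.counit (R := ℂ) (ι b) = 0) :
    MulOpposite.op b • t ∈ augmentation (BTensor B M N) ι := by
  induction t using BTensor.induction_on with
  | zero => rw [smul_zero]; exact zero_mem _
  | add s t hs ht => rw [smul_add]; exact add_mem hs ht
  | tmul m n =>
    rw [BTensor.op_smul_mk]
    have h1 : ∀ n, ∀ m' ∈ augmentation M ι, BTensor.mk B M N m' n ∈
        augmentation (BTensor B M N) ι := by
      intro n m' hm'
      induction hm' using Submodule.span_induction with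
      | mem x hx =>
        obtain ⟨c, x, hc, rfl⟩ := hx
        exact Submodule.subset_span ⟨c, BTensor.mk B M N x n, hc, (BTensor.smul_mk B c x n).symm⟩
      | zero => simp
      | add x y _ _ hx hy => rw [map_add]; exact add_mem hx hy
      | smul z x _ hx => rw [map_smul]; exact Submodule.smul_mem _ z hx
    have h2 : ∀ n' ∈ augmentation N ι, BTensor.mk B M N m n' ∈
        augmentation (BTensor B M N) ι := by
      intro n' hn'
      induction hn' using Submodule.span_induction with
      | mem x hx =>
        obtain ⟨c, x, hc, rfl⟩ := hx
        rw [← BTensor.mk_balanced]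
        exact h1 x _ (hM c m hc)
      | zero => simp
      | add x y _ _ hx hy => rw [map_add]; exact add_mem hx hy
      | smul z x _ hx => rw [map_smul]; exact Submodule.smul_mem _ z hx
    exact h2 _ (hN b n hb)

/-! ### Two-forms as sums of products of one-forms -/

namespace DifferentialCalculus

variable {B : Type*} [Ring B] [Algebra ℂ B] {Ω : Type*} [Ring Ω] [Algebra ℂ Ω]
  {deg : ℕ → Submodule ℂ Ω} [GradedAlgebra deg]

theorem decompose_two_mem (C : DifferentialCalculus B deg) (x : Ω) :
    (DirectSum.decompose deg x 2 : Ω) ∈ deg 1 * deg 1 := by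
  have hleft : ∀ b : B, ∀ y ∈ deg 1 * deg 1, C.ofB b * y ∈ deg 1 * deg 1 := by
    intro b y hy
    induction hy using Submodule.mul_induction_on' with
    | mem_mul_mem ω hω η hη =>
      rw [← mul_assoc]
      refine Submodule.mul_mem_mul ?_ hη
      simpa using SetLike.mul_mem_graded (C.ofB_mem b) hω
    | add x _ y _ hx hy => rw [mul_add]; exact add_mem hx hy
  -- Left multiplication by any `x` preserves the condition `y₂ ∈ Ω¹Ω¹` on degree-two components.
  -- For generators, `(b y)₂ = b y₂` and `(db y)₂ = db y₁`; the latter lies in `Ω¹Ω¹` for every `y`.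
  have key : ∀ x ∈ Algebra.adjoin ℂ (Set.range C.ofB ∪ Set.range fun b => C.d (C.ofB b)),
      ∀ y : Ω, (DirectSum.decompose deg y 2 : Ω) ∈ deg 1 * deg 1 →
        (DirectSum.decompose deg (x * y) 2 : Ω) ∈ deg 1 * deg 1 := by
    intro x hx
    induction hx using Algebra.adjoin_induction with
    | mem x hx =>
      intro y hy
      rcases hx with ⟨b, rfl⟩ | ⟨b, rfl⟩
      · rw [DirectSum.coe_decompose_mul_of_left_mem_zero deg (C.ofB_mem b)]
        exact hleft b _ hy
      · have hd : C.d (C.ofB b) ∈ deg 1 := C.d_mem 0 _ (C.ofB_mem b)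
        rw [DirectSum.coe_decompose_mul_of_left_mem_of_le deg hd one_le_two]
        exact Submodule.mul_mem_mul hd (DirectSum.decompose deg y 1).2
    | algebraMap r =>
      intro y hy
      rw [← Algebra.smul_def, DirectSum.decompose_smul]
      exact Submodule.smul_mem _ r hy
    | add x x' _ _ hx hx' =>
      intro y hy
      rw [add_mul, DirectSum.decompose_add]
      exact add_mem (hx y hy) (hx' y hy)
    | mul x x' _ _ hx hx' =>
      intro y hy
      rw [mul_assoc]
      exact hx _ (hx' y hy)
  -- Start from `y = 1`, whose degree-two component is zero.
  have h := key x (C.adjoin_eq_top ▸ Algebra.mem_top) 1 (by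
    rw [DirectSum.decompose_of_mem_ne deg SetLike.GradedOne.one_mem (by decide)]
    exact zero_mem _)
  rwa [mul_one] at h

theorem wedge_one_one_surjective (C : DifferentialCalculus B deg) :
    Function.Surjective (C.wedge 1 1) := by
  intro ω
  have h : C.incl 2 ω ∈ deg 1 * deg 1 := by
    have := C.decompose_two_mem (C.incl 2 ω)
    rwa [DirectSum.decompose_of_mem_same deg (show C.incl 2 ω ∈ deg 2 from ω.2)] at this
  have h' : ∀ y ∈ deg 1 * deg 1, ∃ t, C.incl 2 (C.wedge 1 1 t) = y := by
    intro y hy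
    induction hy using Submodule.mul_induction_on' with
    | mem_mul_mem ω hω η hη =>
      exact ⟨BTensor.mk B (C.Form 1) (C.Form 1) ⟨ω, hω⟩ ⟨η, hη⟩,
        congrArg (C.incl 2) (BTensor.lift_mk B _ _ _ _)⟩
    | add x _ y _ hx hy =>
      obtain ⟨s, rfl⟩ := hx
      obtain ⟨t, rfl⟩ := hy
      exact ⟨s + t, by rw [map_add]; exact map_add (C.incl 2) _ _⟩
  obtain ⟨t, ht⟩ := h' _ h
  exact ⟨t, C.incl_injective 2 ht⟩

end DifferentialCalculus

end Calculus

end QHS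

end

open QHS
theorem mainTheorem7 {A H : Type u} [Ring A] [HopfAlgebra ℂ A] [Ring H] [HopfAlgebra ℂ H]
    (hA : Function.Bijective (HopfAlgebra.antipode ℂ (A := A)))
    (hH : Function.Bijective (HopfAlgebra.antipode ℂ (A := H)))
    (π : A →ₐc[ℂ] H) (hB : IsQuantumHomogeneousSpace π) (hcs : IsCosemisimple H)
    {Ω : Type u} [Ring Ω] [Algebra ℂ Ω] (deg : ℕ → Submodule ℂ Ω) [GradedAlgebra deg]
    (C : DifferentialCalculus (coinvariants π) deg)
    [∀ k, LeftComodule A (C.Form k)] [∀ k, IsRelHopfBimodule A (coinvariants π) (C.Form k)]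
    (hC : C.IsCovariant A) (hzero : ∀ k, IsModZero π (C.Form k)) :
    C.IsCovariantlyQuasiTame A := by
  obtain ⟨h, h_one, h_inv⟩ := hcs.exists_haar
  obtain ⟨E, hE⟩ := exists_isExpectation π h h_one h_inv
  -- From `Ω^k B⁺ = B⁺ Ω^k` the inclusion needed for right `B`-linearity of averaging is extracted.
  have hForm : ∀ k (b : coinvariants π) (ω : C.Form k),
      Coalgebra.counit (R := ℂ) ((coinvariants π).val b) = 0 →
      MulOpposite.op b • ω ∈ augmentation (C.Form k) (coinvariants π).val := fun k b ω hb =>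
    (hzero k).comm.le (Submodule.subset_span ⟨ω, b, hb, rfl⟩)
  exact hE.exists_section (hC.wedge_morphism 1 1) C.wedge_one_one_surjective
    (op_smul_bTensor_mem_augmentation _ _ _ (hForm 1) (hForm 1)) (hForm 2)
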